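/- Let $x_1,\dots,x_n\in\mathbb R^d$ with $\|x_i\|_2=1$, let $y\in\mathbb R^n$ with $|y_i|\le 1$, and let $\tilde y\in\{-1,1\}^n$ be any realization of a vector of independent uniform random signs that is independent of the initialization below. Consider the two-layer ReLU network $f_W(x)=\frac1{\sqrt m}\sum_{r=1}^m a_r\,\sigma(w_r^{T}x)$, $\sigma(z)=\max\{z,0\}$, $W=(w_1,\dots,w_m)$, and write $\mathbf f_W=(f_W(x_1),\dots,f_W(x_n))^T$. At initialization the $w_r(0)\sim\mathcal N(0,\kappa^2 I)$ and the $a_r$, uniform on $\{-1,1\}$, are all independent, with $0<\kappa\le 1$; the $a_r$ stay fixed. The vectors $w_r$ are trained by gradient descent with learning rate $\eta>0$, first for $k\ge 0$ steps on $\frac12\|\mathbf f_W-y\|_2^2$ and then for $\tilde k\ge 0$ steps on $\frac12\|\mathbf f_W-\tilde y\|_2^2$, where the derivative of $\sigma$ is taken to be $\mathbb I\{z\ge 0\}$; $W(t)$ denotes the weights after $t$ steps. Let $\mathbf H^\infty$ be the $n\times n$ matrix with entries $$\mathbf H^\infty_{ij}=\mathbb E_{w\sim\mathcal N(0,I)}\big[x_i^{T}x_j\,\mathbb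 I\{w^{T}x_i\ge 0,\ w^{T}x_j\ge 0\}\big],$$ let $\mathbf H^\infty=\sum_{i=1}^n\lambda_i v_iv_i^{T}$ be an eigen-decomposition with orthonormal $v_i$, and assume $\lambda_0:=\min_i\lambda_i>0$. There are universal constants $c_1,c_2,c_3>0$ such that for all such data, all $\varepsilon>0$ and $\delta\in(0,1]$, and all $k,\tilde k\ge 0$: if $$\kappa\le c_1\frac{\varepsilon\sqrt\delta\,\lambda_0}{n^{3/2}},\qquad m\ge c_2\max\Big\{\frac{n^9}{\lambda_0^6\varepsilon^2\kappa^2\delta^4},\ \frac{n^6}{\lambda_0^4\kappa^2\delta^3}\Big\},\qquad \eta\le c_3\frac{\lambda_0}{n^2},$$ then with probability at least $1-\delta$ over the random initialization $(W(0),a)$, $$\left|\ \|\mathbf f_{W(k+\tilde k)}-\tilde y\|_2-\sqrt{\sum_{i=1}^n\big[v_i^{T}y-v_i^{T}\tilde y-(1-\eta\lambda_i)^k v_i^{T}y\big]^2(1-\eta\lambda_i)^{2\tilde k}}\ \right|\le\varepsilon .$$ (The second term of the maximum is at most the first one whenever $\varepsilon\le n^{3/2}/(\lambda_0\sqrt\delta)$,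 so it matters only for larger, uninteresting $\varepsilon$.) -/

import Mathlib

open MeasureTheory ProbabilityTheory

noncomputable section

namespace TwoLayer

/-- The ReLU non-linearity `σ(z) = max{z, 0}`. -/
def relu (z : ℝ) : ℝ := max z 0

/-- The derivative of the ReLU, with the usual convention that it is `1` at the origin:
the indicator `𝕀{z ≥ 0}`. -/
def reluDeriv (z : ℝ) : ℝ := if 0 ≤ z then 1 else 0

/-- The two-layer network `f_W(x) = (1/√m) ∑_r a_r σ(w_rᵀ x)` with `m` hidden units. -/
def net {m d : ℕ} (a : Fin m → ℝ) (W : Fin m → EuclideanSpace ℝ (Fin d))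
    (x : EuclideanSpace ℝ (Fin d)) : ℝ :=
  1 / √(m : ℝ) * ∑ r, a r * relu (inner ℝ (W r) x)

/-- The vector `(f_W(x_1), …, f_W(x_n))` of outputs on the input samples. -/
def outputs {m d n : ℕ} (x : Fin n → EuclideanSpace ℝ (Fin d)) (a : Fin m → ℝ)
    (W : Fin m → EuclideanSpace ℝ (Fin d)) : EuclideanSpace ℝ (Fin n) :=
  WithLp.toLp 2 fun i => net a W (x i)

/-- The objective `½ ‖f_W - u‖₂²` for the label vector `u`. -/
def objective {m d n : ℕ} (x : Fin n → EuclideanSpace ℝ (Fin d)) (u : EuclideanSpace ℝ (Fin n))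
    (a : Fin m → ℝ) (W : Fin m → EuclideanSpace ℝ (Fin d)) : ℝ :=
  1 / 2 * ‖outputs x a W - u‖ ^ 2

/-- The partial gradient of the objective with respect to `w_r`, namely
`(a_r/√m) ∑_i (f_W(x_i) - u_i) 𝕀{w_rᵀ x_i ≥ 0} x_i`.
See `hasGradientAt_objective`. -/
def objectiveGrad {m d n : ℕ} (x : Fin n → EuclideanSpace ℝ (Fin d))
    (u : EuclideanSpace ℝ (Fin n)) (a : Fin m → ℝ) (W : Fin m → EuclideanSpace ℝ (Fin d))
    (r : Fin m) : EuclideanSpace ℝ (Fin d) :=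
  (a r / √(m : ℝ)) • ∑ i, ((net a W (x i) - u i) * reluDeriv (inner ℝ (W r) (x i))) • x i

/-- Where no kink of the ReLU is hit, `objectiveGrad` is the gradient of the objective as a
function of the single weight vector `w_r`. -/
theorem hasGradientAt_objective {m d n : ℕ} (x : Fin n → EuclideanSpace ℝ (Fin d))
    (u : EuclideanSpace ℝ (Fin n)) (a : Fin m → ℝ) (W : Fin m → EuclideanSpace ℝ (Fin d))
    (r : Fin m) (h : ∀ i, inner ℝ (W r) (x i) ≠ 0) :
    HasGradientAt (fun w => objective x u a (Function.update W r w)) (objectiveGrad x u a W r)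
      (W r) := by
  have hrelu : ∀ z : ℝ, z ≠ 0 → HasDerivAt relu (reluDeriv z) z := by
    intro z hz
    rcases lt_or_gt_of_ne hz with hz | hz
    · have h0 : HasDerivAt (fun _ : ℝ => (0 : ℝ)) 0 z := hasDerivAt_const z 0
      have : reluDeriv z = 0 := by simp [reluDeriv, not_le.mpr hz]
      rw [this]
      refine h0.congr_of_eventuallyEq ?_
      filter_upwards [eventually_lt_nhds hz] with t ht
      simp [relu, ht.le]
    · have : reluDeriv z = 1 := by simp [reluDeriv, hz.le]
      rw [this]
      refine (hasDerivAt_id z).congr_of_eventuallyEq ?_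
      filter_upwards [eventually_gt_nhds hz] with t ht
      simp [relu, ht.le]
  have hin : ∀ i, HasFDerivAt (fun w : EuclideanSpace ℝ (Fin d) => inner ℝ w (x i))
      (innerSL ℝ (x i)) (W r) := by
    intro i
    have := (innerSL ℝ (x i)).hasFDerivAt (x := W r)
    refine this.congr_of_eventuallyEq (Filter.Eventually.of_forall fun w => ?_)
    simp [real_inner_comm]
  have hnet : ∀ i, HasFDerivAt (fun w => net a (Function.update W r w) (x i))
      ((1 / √(m : ℝ) * (a r * reluDeriv (inner ℝ (W r) (x i)))) • innerSL ℝ (x i)) (W r) := by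
    intro i
    have hs : ∀ s : Fin m, HasFDerivAt
        (fun w => a s * relu (inner ℝ (Function.update W r w s) (x i)))
        (if s = r then (a r * reluDeriv (inner ℝ (W r) (x i))) • innerSL ℝ (x i) else 0)
        (W r) := by
      intro s
      by_cases hsr : s = r
      · subst hsr
        simp only [Function.update_self, if_true]
        have := ((hrelu _ (h i)).comp_hasFDerivAt (W s) (hin i)).const_mul (a s)
        simpa [smul_smul] using this
      · simp only [Function.update_of_ne hsr, hsr, if_false]
        exact hasFDerivAt_const _ _
    have := (HasFDerivAt.fun_sum (u := Finset.univ) fun s _ => hs s).const_mul (1 / √(m : ℝ))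
    simpa [net, smul_smul] using this
  have hobj : (fun w => objective x u a (Function.update W r w)) =
      fun w => 1 / 2 * ∑ i, (net a (Function.update W r w) (x i) - u i) ^ 2 := by
    funext w
    simp [objective, outputs, EuclideanSpace.norm_sq_eq]
  rw [hasGradientAt_iff_hasFDerivAt, hobj]
  have hsum := (HasFDerivAt.fun_sum (u := Finset.univ)
    fun i _ => ((hnet i).sub_const (u i)).pow 2).const_mul (1 / 2 : ℝ)
  refine hsum.congr_fderiv ?_
  ext v
  simp [objectiveGrad, Finset.mul_sum]
  refine Finset.sum_congr rfl fun i _ => ?_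
  ring

/-- The gradient-descent trajectory: learning rate `η`, initial weights `W₀`, fixed second layer
`a`; the first `k` steps are taken on the labels `y`, all the following ones on the labels `y'`. -/
def weights {m d n : ℕ} (η : ℝ) (x : Fin n → EuclideanSpace ℝ (Fin d))
    (y y' : EuclideanSpace ℝ (Fin n)) (k : ℕ) (a : Fin m → ℝ)
    (W₀ : Fin m → EuclideanSpace ℝ (Fin d)) : ℕ → Fin m → EuclideanSpace ℝ (Fin d)
  | 0 => W₀
  | t + 1 => fun r => weights η x y y' k a W₀ t r -
      η • objectiveGrad x (if t < k then y else y') a (weights η x y y' k a W₀ t) r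

/-- The law of the random initialization `(W(0), a)`: independent `w_r(0) ∼ N(0, κ² I)` and
independent `a_r` uniform on `{-1, 1}`. -/
def initLaw (m d : ℕ) (κ : ℝ) :
    Measure ((Fin m → EuclideanSpace ℝ (Fin d)) × (Fin m → ℝ)) :=
  (Measure.pi fun _ => multivariateGaussian 0 (κ ^ 2 • (1 : Matrix (Fin d) (Fin d) ℝ))).prod
    (Measure.pi fun _ => uniformOn {-1, 1})

/-- The infinite-width Gram matrix
`H^∞_{ij} = 𝔼_{w ∼ N(0, I)} [x_iᵀ x_j 𝕀{wᵀ x_i ≥ 0, wᵀ x_j ≥ 0}]`. -/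
def gramInf {n d : ℕ} (x : Fin n → EuclideanSpace ℝ (Fin d)) : Matrix (Fin n) (Fin n) ℝ :=
  Matrix.of fun i j => ∫ w, inner ℝ (x i) (x j) *
    {w | 0 ≤ inner ℝ w (x i) ∧ 0 ≤ inner ℝ w (x j)}.indicator (fun _ => (1 : ℝ)) w
      ∂(stdGaussian (EuclideanSpace ℝ (Fin d)))

end TwoLayer

end

namespace TwoLayer

/-! ### Elementary facts on the ReLU -/

/-! Write ζ for the residual, H for `gramInf x` and λ₀ for its least eigenvalue. Between two weight
vectors the ReLU changes by exactly a secant slope in `[0, 1]` times the change of its argument, so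
a gradient step is exactly ζ ↦ ζ - ηGζ for some matrix G (`exists_step_matrix`), with no
second-order remainder. Only neurons whose initial pre-activation is within the distance travelled
can make G differ from the initial Gram matrix, and few neurons are that close to a kink.

If ‖(G - H)z‖ ≤ ρ‖z‖ with ρ ≤ λ₀/2, a step contracts ζ by the factor 1 - ηλ₀/2, whence η‖ζ‖ ≤
(2/λ₀)(‖ζ‖ - ‖ζ'‖). The right-hand side telescopes. The norm of ζ thus pays for both the distance
travelled by each neuron, at rate √n/√m, and the deviation from the linear dynamics 1 - ηH, at rate
ρ (`gradientDescent_near_kernel`). Changing the labels only adds ‖y - y'‖ to this budget, so the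
second phase keeps the same reference point W(0) and the same ρ (`abs_norm_residual_sub_le`). In an
eigenbasis of H the linear dynamics, started from zero output, is the stated square root.

The randomness enters through three moments, each combined with Markov's inequality at level δ/3
(`measure_not_typicalInit_le`). The squared norm of the initial outputs has mean at most nκ². A
neuron is within R of a kink with probability at most R/κ. Each entry of the initial Gram matrix has
variance at most 1/m. Hence a small κ makes the initial output negligible, and a large m compensates
for the factor 1/κ in the kink probability. -/

lemma measurable_relu : Measurable relu := measurable_id.max measurable_const

lemma measurable_reluDeriv : Measurable reluDeriv :=
  Measurable.ite measurableSet_Ici measurable_const measurable_const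

lemma reluDeriv_nonneg (z : ℝ) : 0 ≤ reluDeriv z := by
  unfold reluDeriv; split_ifs <;> norm_num

lemma reluDeriv_le_one (z : ℝ) : reluDeriv z ≤ 1 := by
  unfold reluDeriv; split_ifs <;> norm_num

lemma relu_sq_le (z : ℝ) : relu z ^ 2 ≤ z ^ 2 := by
  unfold relu
  rcases le_total z 0 with h | h
  · rw [max_eq_right h]; nlinarith [sq_nonneg z]
  · rw [max_eq_left h]

lemma abs_inner_le_one {E : Type*} [NormedAddCommGroup E] [InnerProductSpace ℝ E] {x y : E}
    (hx : ‖x‖ = 1) (hy : ‖y‖ = 1) : |inner ℝ x y| ≤ 1 := by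
  simpa [hx, hy] using abs_real_inner_le_norm x y

/-! ### The law of a single neuron -/

lemma stdGaussian_map_inner {d : ℕ} {x : EuclideanSpace ℝ (Fin d)} (hx : ‖x‖ = 1) :
    (stdGaussian (EuclideanSpace ℝ (Fin d))).map (fun w => inner ℝ w x) = gaussianReal 0 1 := by
  have h := IsGaussian.map_eq_gaussianReal (μ := stdGaussian (EuclideanSpace ℝ (Fin d)))
    (innerSL ℝ x)
  rw [integral_strongDual_stdGaussian, variance_dual_stdGaussian, innerSL_apply_norm, hx] at h
  have hf : (fun w => inner ℝ w x) = ⇑(innerSL ℝ x) := by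
    funext w; simp [real_inner_comm]
  rw [hf, h]
  simp

lemma multivariateGaussian_sq_smul_one {d : ℕ} {κ : ℝ} (hκ : 0 ≤ κ) :
    multivariateGaussian 0 (κ ^ 2 • (1 : Matrix (Fin d) (Fin d) ℝ)) =
      (stdGaussian (EuclideanSpace ℝ (Fin d))).map (fun w => κ • w) := by
  open scoped MatrixOrder in
  have hs : CFC.sqrt (κ ^ 2 • (1 : Matrix (Fin d) (Fin d) ℝ)) = κ • 1 := by
    refine CFC.sqrt_unique ?_ ?_
    · simp [smul_smul, pow_two]
    · exact (Matrix.PosSemidef.one.smul hκ).nonneg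
  rw [multivariateGaussian, hs]
  congr 1
  funext w
  simp

lemma multivariateGaussian_map_inner {d : ℕ} {κ : ℝ} (hκ : 0 ≤ κ)
    {x : EuclideanSpace ℝ (Fin d)} (hx : ‖x‖ = 1) :
    (multivariateGaussian 0 (κ ^ 2 • (1 : Matrix (Fin d) (Fin d) ℝ))).map
      (fun w => inner ℝ w x) = gaussianReal 0 (NNReal.mk (κ ^ 2) (sq_nonneg κ)) := by
  rw [multivariateGaussian_sq_smul_one hκ, Measure.map_map (by fun_prop) (by fun_prop)]
  have : ((fun w : EuclideanSpace ℝ (Fin d) => inner ℝ w x) ∘ fun w => κ • w) =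
      (fun z => κ * z) ∘ fun w => inner ℝ w x := by
    funext w; simp [real_inner_smul_left]
  rw [this, ← Measure.map_map (by fun_prop) (by fun_prop), stdGaussian_map_inner hx,
    gaussianReal_map_const_mul]
  simp

/-- The density is at most 1/(2κ), because √(2π) ≥ 2, and the interval has length 2R. -/
lemma gaussianReal_abs_le {κ R : ℝ} (hκ : 0 < κ) (hR : 0 ≤ R) :
    (gaussianReal 0 (NNReal.mk (κ ^ 2) (sq_nonneg κ))).real {z | |z| ≤ R} ≤ R / κ := by
  have hv : NNReal.mk (κ ^ 2) (sq_nonneg κ) ≠ 0 := by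
    intro h
    have := congrArg NNReal.toReal h
    simp at this
    exact hκ.ne' this
  have hset : {z : ℝ | |z| ≤ R} = Set.Icc (-R) R := by
    ext z; simp [abs_le]
  have hpdf : ∀ z, gaussianPDF 0 (NNReal.mk (κ ^ 2) (sq_nonneg κ)) z ≤
      ENNReal.ofReal (1 / (2 * κ)) := by
    intro z
    refine ENNReal.ofReal_le_ofReal ?_
    unfold gaussianPDFReal
    have h1 : 2 * κ ≤ √(2 * Real.pi * κ ^ 2) := by
      apply Real.le_sqrt_of_sq_le
      nlinarith [Real.pi_gt_three, sq_nonneg κ]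
    have h2 : Real.exp (-(z - 0) ^ 2 / (2 * κ ^ 2)) ≤ 1 := by
      rw [Real.exp_le_one_iff]
      apply div_nonpos_of_nonpos_of_nonneg <;> nlinarith [sq_nonneg (z - 0), sq_nonneg κ]
    have h3 : (√(2 * Real.pi * κ ^ 2))⁻¹ ≤ 1 / (2 * κ) := by
      rw [one_div]
      exact inv_anti₀ (by positivity) h1
    calc _ ≤ 1 / (2 * κ) * 1 := by
          refine mul_le_mul h3 h2 (Real.exp_nonneg _) (by positivity)
      _ = _ := mul_one _
  rw [Measure.real, gaussianReal_apply 0 hv, hset]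
  refine ENNReal.toReal_le_of_le_ofReal (by positivity) ?_
  calc _ ≤ ∫⁻ _ in Set.Icc (-R) R, ENNReal.ofReal (1 / (2 * κ)) := lintegral_mono hpdf
    _ = ENNReal.ofReal (1 / (2 * κ)) * ENNReal.ofReal (R - -R) := by
        rw [lintegral_const, Measure.restrict_apply_univ, Real.volume_Icc]
    _ = ENNReal.ofReal (R / κ) := by
        rw [← ENNReal.ofReal_mul (by positivity)]
        congr 1
        field_simp
        ring

lemma multivariateGaussian_abs_inner_le {d : ℕ} {κ R : ℝ} (hκ : 0 < κ) (hR : 0 ≤ R)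
    {x : EuclideanSpace ℝ (Fin d)} (hx : ‖x‖ = 1) :
    (multivariateGaussian 0 (κ ^ 2 • (1 : Matrix (Fin d) (Fin d) ℝ))).real
      {w | |inner ℝ w x| ≤ R} ≤ R / κ := by
  have h := gaussianReal_abs_le hκ hR
  have hs : MeasurableSet {z : ℝ | |z| ≤ R} := measurableSet_le (by fun_prop) (by fun_prop)
  rw [← multivariateGaussian_map_inner hκ.le hx, map_measureReal_apply (by fun_prop) hs] at h
  exact h

lemma lintegral_relu_inner_sq_le {d : ℕ} {κ : ℝ} (hκ : 0 < κ)
    {x : EuclideanSpace ℝ (Fin d)} (hx : ‖x‖ = 1) :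
    ∫⁻ w, ENNReal.ofReal (relu (inner ℝ w x) ^ 2)
      ∂(multivariateGaussian 0 (κ ^ 2 • (1 : Matrix (Fin d) (Fin d) ℝ))) ≤
        ENNReal.ofReal (κ ^ 2) := by
  have hm : MemLp id 2 (gaussianReal 0 (NNReal.mk (κ ^ 2) (sq_nonneg κ))) :=
    memLp_id_gaussianReal 2
  calc _ ≤ ∫⁻ w, ENNReal.ofReal ((inner ℝ w x) ^ 2)
        ∂(multivariateGaussian 0 (κ ^ 2 • (1 : Matrix (Fin d) (Fin d) ℝ))) :=
        lintegral_mono fun w => ENNReal.ofReal_le_ofReal (relu_sq_le _)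
    _ = ∫⁻ z, ENNReal.ofReal (z ^ 2)
        ∂((multivariateGaussian 0 (κ ^ 2 • (1 : Matrix (Fin d) (Fin d) ℝ))).map
          (fun w => inner ℝ w x)) := by
        rw [lintegral_map (by fun_prop) (by fun_prop)]
    _ = ENNReal.ofReal (∫ z, z ^ 2 ∂(gaussianReal 0 (NNReal.mk (κ ^ 2) (sq_nonneg κ)))) := by
        rw [multivariateGaussian_map_inner hκ.le hx, ofReal_integral_eq_lintegral_ofReal]
        · exact hm.integrable_sq
        · exact ae_of_all _ fun z => sq_nonneg z
    _ = _ := by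
        congr 1
        have := variance_id_gaussianReal (μ := 0) (v := NNReal.mk (κ ^ 2) (sq_nonneg κ))
        rw [variance_of_integral_eq_zero (by fun_prop) (by simp)] at this
        simpa using this

/-- The indicator in `gramInf` is scale invariant, so the variance of the weights is irrelevant. -/
lemma integral_reluDeriv_mul_eq_gramInf {n d : ℕ} {κ : ℝ} (hκ : 0 < κ)
    (x : Fin n → EuclideanSpace ℝ (Fin d)) (i j : Fin n) :
    ∫ w, inner ℝ (x i) (x j) * (reluDeriv (inner ℝ w (x i)) * reluDeriv (inner ℝ w (x j)))
      ∂(multivariateGaussian 0 (κ ^ 2 • (1 : Matrix (Fin d) (Fin d) ℝ))) = gramInf x i j := by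
  have hmeas : ∀ i, Measurable fun w : EuclideanSpace ℝ (Fin d) =>
      reluDeriv (inner ℝ w (x i)) := fun i => measurable_reluDeriv.comp (by fun_prop)
  have hprod : Measurable fun w : EuclideanSpace ℝ (Fin d) => inner ℝ (x i) (x j) *
      (reluDeriv (inner ℝ w (x i)) * reluDeriv (inner ℝ w (x j))) :=
    ((hmeas i).mul (hmeas j)).const_mul _
  rw [multivariateGaussian_sq_smul_one hκ.le, integral_map (by fun_prop)
    hprod.aestronglyMeasurable]
  simp only [gramInf, Matrix.of_apply]
  refine integral_congr_ae (ae_of_all _ fun w => ?_)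
  simp only [real_inner_smul_left, reluDeriv, Set.indicator, Set.mem_ofPred_eq,
    mul_nonneg_iff_of_pos_left hκ]
  split_ifs <;> simp_all

/-! ### Random signs -/

instance : IsProbabilityMeasure (uniformOn ({-1, 1} : Set ℝ)) :=
  isProbabilityMeasure_uniformOn (Set.toFinite _) (by simp)

lemma ae_sign : ∀ᵐ a ∂(uniformOn ({-1, 1} : Set ℝ)), a = -1 ∨ a = 1 := by
  have h := uniformOn_self (s := ({-1, 1} : Set ℝ)) (Set.toFinite _) (by simp)
  have := (prob_compl_eq_zero_iff (Set.toFinite ({-1, 1} : Set ℝ)).measurableSet).2 h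
  rw [ae_iff]
  exact this

lemma integral_sign : ∫ a, a ∂(uniformOn ({-1, 1} : Set ℝ)) = 0 := by
  have hint : IntegrableOn (fun a : ℝ => a) (({-1, 1} : Finset ℝ) : Set ℝ) Measure.count := by
    rw [Finset.coe_pair, Set.insert_eq, integrableOn_union]
    constructor <;> refine integrableOn_singleton (by simp) (by simp)
  rw [uniformOn, ProbabilityTheory.cond, integral_smul_measure, ← Finset.coe_pair,
    setIntegral_finset _ hint, Finset.sum_pair (by norm_num)]
  simp [Measure.real]

lemma memLp_sign : MemLp (fun a : ℝ => a) 2 (uniformOn ({-1, 1} : Set ℝ)) := by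
  refine MemLp.of_bound (by fun_prop) 1 ?_
  filter_upwards [ae_sign] with a ha
  rcases ha with rfl | rfl <;> simp

lemma variance_sign : Var[fun a => a; uniformOn ({-1, 1} : Set ℝ)] = 1 := by
  rw [variance_of_integral_eq_zero (by fun_prop) integral_sign]
  rw [integral_congr_ae (g := fun _ => (1 : ℝ))]
  · simp
  · filter_upwards [ae_sign] with a ha
    rcases ha with rfl | rfl <;> simp

/-! ### One step of gradient descent as a linear map -/

/-- The slope of the secant of the ReLU between `p` and `q` lies in `[0, 1]`, and it is the
derivative at any `z` that has the same strict sign as `p` and `q`. -/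
lemma exists_relu_secant (p q : ℝ) :
    ∃ θ ∈ Set.Icc (0 : ℝ) 1, relu q - relu p = θ * (q - p) ∧
      (0 < p → 0 < q → θ = 1) ∧ (p < 0 → q < 0 → θ = 0) := by
  have key : ∀ p q : ℝ, p < q → ∃ θ ∈ Set.Icc (0 : ℝ) 1, relu q - relu p = θ * (q - p) ∧
      (0 < p → 0 < q → θ = 1) ∧ (p < 0 → q < 0 → θ = 0) := by
    intro p q hpq
    have hne : q - p ≠ 0 := by linarith
    refine ⟨(relu q - relu p) / (q - p), ⟨?_, ?_⟩, by field_simp, fun hp hq => ?_, fun hp hq => ?_⟩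
    · exact div_nonneg (sub_nonneg.2 (max_le_max_right 0 hpq.le)) (by linarith)
    · rw [div_le_one (by linarith)]
      unfold relu
      rcases max_cases p 0 with h | h <;> rcases max_cases q 0 with h' | h' <;> linarith
    · simp [relu, max_eq_left hp.le, max_eq_left hq.le, div_self hne]
    · simp [relu, max_eq_right hp.le, max_eq_right hq.le]
  rcases lt_trichotomy p q with h | h | h
  · exact key p q h
  · subst h
    -- When the endpoints coincide every slope satisfies the secant equation, and this one also
    -- obeys the sign conditions.
    refine ⟨if 0 < p then 1 else 0, ?_, by simp, fun h _ => by simp [h],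
      fun h _ => by simp [h.le]⟩
    split_ifs <;> simp
  · obtain ⟨θ, h1, h2, h3, h4⟩ := key q p h
    exact ⟨θ, h1, by linarith, fun a b => h3 b a, fun a b => h4 b a⟩

/-- The Gram matrix of the network with weights `W`. -/
noncomputable def gram {m d n : ℕ} (x : Fin n → EuclideanSpace ℝ (Fin d)) (W : Fin m → EuclideanSpace ℝ (Fin d)) :
    Matrix (Fin n) (Fin n) ℝ :=
  Matrix.of fun i j => 1 / (m : ℝ) * ∑ r, inner ℝ (x i) (x j) *
    (reluDeriv (inner ℝ (W r) (x i)) * reluDeriv (inner ℝ (W r) (x j)))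

/-- The indicator that the pre-activation of `w` at `x` is at most `R` in absolute value. -/
noncomputable def nearKink {d : ℕ} (R : ℝ) (w x : EuclideanSpace ℝ (Fin d)) : ℝ :=
  if |inner ℝ w x| ≤ R then 1 else 0

/-- The fraction of the neurons whose pre-activation at `x` is at most `R` in absolute value. -/
noncomputable def nearKinkFraction {m d : ℕ} (R : ℝ) (W : Fin m → EuclideanSpace ℝ (Fin d))
    (x : EuclideanSpace ℝ (Fin d)) : ℝ :=
  1 / (m : ℝ) * ∑ r, nearKink R (W r) x

lemma nearKink_nonneg {d : ℕ} (R : ℝ) (w x : EuclideanSpace ℝ (Fin d)) : 0 ≤ nearKink R w x := by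
  unfold nearKink; split_ifs <;> norm_num

lemma nearKinkFraction_nonneg {m d : ℕ} (R : ℝ) (W : Fin m → EuclideanSpace ℝ (Fin d))
    (x : EuclideanSpace ℝ (Fin d)) : 0 ≤ nearKinkFraction R W x :=
  mul_nonneg (by positivity) (Finset.sum_nonneg fun _ _ => nearKink_nonneg _ _ _)

/-- A move by at most `R` does not change the sign of a pre-activation exceeding `R`. -/
lemma sign_inner_of_norm_sub_le {d : ℕ} {R : ℝ} {w₀ w x : EuclideanSpace ℝ (Fin d)}
    (hx : ‖x‖ = 1) (hw : ‖w - w₀‖ ≤ R) (hR : R < |inner ℝ w₀ x|) :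
    (0 < inner ℝ w₀ x ∧ 0 < inner ℝ w x) ∨ (inner ℝ w₀ x < 0 ∧ inner ℝ w x < 0) := by
  have h : |inner ℝ w x - inner ℝ w₀ x| ≤ R := by
    rw [← inner_sub_left]
    refine (abs_real_inner_le_norm _ _).trans ?_
    rwa [hx, mul_one]
  rw [abs_le] at h
  rcases lt_abs.1 hR with h' | h'
  · left; constructor <;> linarith [norm_nonneg (w - w₀)]
  · right; constructor <;> linarith [norm_nonneg (w - w₀)]

/-- If neither initial pre-activation is within `R` of the kink, all signs are frozen and the two
products agree. Otherwise the right-hand side is at least 1, which bounds the difference of two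
numbers in `[0, 1]`. -/
lemma abs_mul_sub_mul_reluDeriv_le {d : ℕ} {R θ : ℝ} {w₀ w w' x x' : EuclideanSpace ℝ (Fin d)}
    (hx : ‖x‖ = 1) (hx' : ‖x'‖ = 1) (hw : ‖w - w₀‖ ≤ R) (hw' : ‖w' - w₀‖ ≤ R)
    (hθ : θ ∈ Set.Icc (0 : ℝ) 1)
    (hpos : 0 < inner ℝ w x → 0 < inner ℝ w' x → θ = 1)
    (hneg : inner ℝ w x < 0 → inner ℝ w' x < 0 → θ = 0) :
    |θ * reluDeriv (inner ℝ w x') - reluDeriv (inner ℝ w₀ x) * reluDeriv (inner ℝ w₀ x')| ≤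
      nearKink R w₀ x + nearKink R w₀ x' := by
  have hle : |θ * reluDeriv (inner ℝ w x') -
      reluDeriv (inner ℝ w₀ x) * reluDeriv (inner ℝ w₀ x')| ≤ 1 := by
    have h1 : θ * reluDeriv (inner ℝ w x') ≤ 1 :=
      mul_le_one₀ hθ.2 (reluDeriv_nonneg _) (reluDeriv_le_one _)
    have h2 : reluDeriv (inner ℝ w₀ x) * reluDeriv (inner ℝ w₀ x') ≤ 1 :=
      mul_le_one₀ (reluDeriv_le_one _) (reluDeriv_nonneg _) (reluDeriv_le_one _)
    have h3 := mul_nonneg hθ.1 (reluDeriv_nonneg (inner ℝ w x'))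
    have h4 := mul_nonneg (reluDeriv_nonneg (inner ℝ w₀ x)) (reluDeriv_nonneg (inner ℝ w₀ x'))
    rw [abs_le]; constructor <;> linarith
  by_cases h : |inner ℝ w₀ x| ≤ R
  · have : nearKink R w₀ x = 1 := if_pos h
    linarith [nearKink_nonneg R w₀ x']
  by_cases h' : |inner ℝ w₀ x'| ≤ R
  · have : nearKink R w₀ x' = 1 := if_pos h'
    linarith [nearKink_nonneg R w₀ x]
  push Not at h h'
  have e1 : reluDeriv (inner ℝ w x') = reluDeriv (inner ℝ w₀ x') := by
    unfold reluDeriv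
    rcases sign_inner_of_norm_sub_le hx' hw h' with ⟨a, b⟩ | ⟨a, b⟩
    · rw [if_pos a.le, if_pos b.le]
    · rw [if_neg a.not_ge, if_neg b.not_ge]
  have e2 : θ = reluDeriv (inner ℝ w₀ x) := by
    unfold reluDeriv
    rcases sign_inner_of_norm_sub_le hx hw h with ⟨a, b⟩ | ⟨a, b⟩ <;>
      rcases sign_inner_of_norm_sub_le hx hw' h with ⟨_, c⟩ | ⟨_, c⟩
    · rw [hpos b c, if_pos a.le]
    · linarith
    · linarith
    · rw [hneg b c, if_neg a.not_ge]
  rw [e1, e2, sub_self, abs_zero]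
  exact add_nonneg (nearKink_nonneg _ _ _) (nearKink_nonneg _ _ _)

/-- A gradient step acts on the residual through a matrix that is close to the Gram matrix at any
reference point `W₀` that is close to both ends of the step. -/
theorem exists_step_matrix {m d n : ℕ} {x : Fin n → EuclideanSpace ℝ (Fin d)}
    (hx : ∀ i, ‖x i‖ = 1) (u : EuclideanSpace ℝ (Fin n)) {a : Fin m → ℝ}
    (ha : ∀ r, a r = -1 ∨ a r = 1) {η R : ℝ} {W₀ W W' : Fin m → EuclideanSpace ℝ (Fin d)}
    (hW' : ∀ r, W' r = W r - η • objectiveGrad x u a W r)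
    (hR : ∀ r, ‖W r - W₀ r‖ ≤ R) (hR' : ∀ r, ‖W' r - W₀ r‖ ≤ R) :
    ∃ G : Matrix (Fin n) (Fin n) ℝ,
      outputs x a W' - u = (outputs x a W - u) - η • G.toEuclideanLin (outputs x a W - u) ∧
      ∀ i j, |G i j - gram x W₀ i j| ≤
        nearKinkFraction R W₀ (x i) + nearKinkFraction R W₀ (x j) := by
  choose θ hθ hsec hpos hneg using fun (r : Fin m) (i : Fin n) =>
    exists_relu_secant (inner ℝ (W r) (x i)) (inner ℝ (W' r) (x i))
  -- Rows carry the secant slope of the output at `x i`, columns the derivative used by the gradient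
  -- at `x j`. This matrix need not be symmetric, so only its distance to a symmetric one is used
  -- later.
  refine ⟨Matrix.of fun i j => 1 / (m : ℝ) * ∑ r, inner ℝ (x i) (x j) *
    (θ r i * reluDeriv (inner ℝ (W r) (x j))), ?_, fun i j => ?_⟩
  · ext i
    have ha2 : ∀ r, a r * a r = 1 := fun r => by rcases ha r with h | h <;> rw [h] <;> norm_num
    have hm : 1 / √(m : ℝ) * (1 / √(m : ℝ)) = 1 / (m : ℝ) := by
      rw [div_mul_div_comm, Real.mul_self_sqrt (Nat.cast_nonneg m), one_mul]
    have hneuron : ∀ r, relu (inner ℝ (W' r) (x i)) = relu (inner ℝ (W r) (x i)) -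
        η * (1 / √(m : ℝ)) * a r * θ r i * ∑ j, (net a W (x j) - u j) *
          reluDeriv (inner ℝ (W r) (x j)) * inner ℝ (x i) (x j) := by
      intro r
      have h : inner ℝ (W' r) (x i) - inner ℝ (W r) (x i) = -(η * (a r / √(m : ℝ) *
          ∑ j, (net a W (x j) - u j) * reluDeriv (inner ℝ (W r) (x j)) *
            inner ℝ (x i) (x j))) := by
        rw [← inner_sub_left, hW' r, sub_sub_cancel_left, inner_neg_left, real_inner_smul_left,
          objectiveGrad, real_inner_smul_left, sum_inner]
        refine congrArg (fun t => -(η * (a r / √(m : ℝ) * t))) (Finset.sum_congr rfl fun j _ => ?_)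
        rw [real_inner_smul_left, real_inner_comm (x i) (x j)]
      rw [sub_eq_iff_eq_add.1 (hsec r i), h]
      ring
    have hnet : net a W' (x i) = net a W (x i) - η * ∑ j, (1 / (m : ℝ) *
        ∑ r, inner ℝ (x i) (x j) * (θ r i * reluDeriv (inner ℝ (W r) (x j)))) *
          (net a W (x j) - u j) := by
      -- The sign occurs once in the output and once in the gradient, so it disappears by `a r * a r
      -- = 1`.
      have hcancel : ∀ r, a r * (η * (1 / √(m : ℝ)) * a r * θ r i *
          ∑ j, (net a W (x j) - u j) * reluDeriv (inner ℝ (W r) (x j)) * inner ℝ (x i) (x j)) =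
          η * (1 / √(m : ℝ)) * (θ r i *
            ∑ j, (net a W (x j) - u j) * reluDeriv (inner ℝ (W r) (x j)) *
              inner ℝ (x i) (x j)) := by
        intro r
        linear_combination (η * (1 / √(m : ℝ)) * (θ r i * ∑ j, (net a W (x j) - u j) *
          reluDeriv (inner ℝ (W r) (x j)) * inner ℝ (x i) (x j))) * ha2 r
      have hswap : ∑ r, θ r i * ∑ j, (net a W (x j) - u j) * reluDeriv (inner ℝ (W r) (x j)) *
            inner ℝ (x i) (x j) =
          ∑ j, (∑ r, inner ℝ (x i) (x j) * (θ r i * reluDeriv (inner ℝ (W r) (x j)))) *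
            (net a W (x j) - u j) := by
        simp only [Finset.mul_sum, Finset.sum_mul]
        rw [Finset.sum_comm]
        exact Finset.sum_congr rfl fun j _ => Finset.sum_congr rfl fun r _ => by ring
      have hexpand : net a W' (x i) = net a W (x i) - 1 / √(m : ℝ) * (η * (1 / √(m : ℝ)) *
          ∑ r, θ r i * ∑ j, (net a W (x j) - u j) * reluDeriv (inner ℝ (W r) (x j)) *
            inner ℝ (x i) (x j)) := by
        rw [Finset.mul_sum, ← Finset.sum_congr rfl fun r _ => hcancel r, net, net, ← mul_sub,
          ← Finset.sum_sub_distrib]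
        simp only [hneuron, mul_sub, net]
      rw [hexpand, hswap]
      simp only [mul_assoc (1 / (m : ℝ))]
      rw [← Finset.mul_sum]
      linear_combination (-η * ∑ j, (∑ r, inner ℝ (x i) (x j) * (θ r i *
        reluDeriv (inner ℝ (W r) (x j)))) * (net a W (x j) - u j)) * hm
    simp only [outputs, PiLp.sub_apply, PiLp.smul_apply, Matrix.toLpLin_apply, Matrix.mulVec,
      dotProduct, Matrix.of_apply, smul_eq_mul]
    rw [hnet]
    ring
  · have : (Matrix.of fun i j => 1 / (m : ℝ) * ∑ r, inner ℝ (x i) (x j) *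
        (θ r i * reluDeriv (inner ℝ (W r) (x j)))) i j - gram x W₀ i j =
        1 / (m : ℝ) * ∑ r, inner ℝ (x i) (x j) * (θ r i * reluDeriv (inner ℝ (W r) (x j)) -
          reluDeriv (inner ℝ (W₀ r) (x i)) * reluDeriv (inner ℝ (W₀ r) (x j))) := by
      simp only [gram, Matrix.of_apply, mul_sub, Finset.sum_sub_distrib]
    rw [this, nearKinkFraction, nearKinkFraction, ← mul_add, ← Finset.sum_add_distrib, abs_mul,
      abs_of_nonneg (by positivity : (0 : ℝ) ≤ 1 / m)]
    refine mul_le_mul_of_nonneg_left ?_ (by positivity)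
    refine (Finset.abs_sum_le_sum_abs _ _).trans (Finset.sum_le_sum fun r _ => ?_)
    rw [abs_mul]
    calc _ ≤ 1 * (nearKink R (W₀ r) (x i) + nearKink R (W₀ r) (x j)) :=
          mul_le_mul (abs_inner_le_one (hx i) (hx j))
            (abs_mul_sub_mul_reluDeriv_le (hx i) (hx j) (hR r) (hR' r) (hθ r i) (hpos r i)
              (hneg r i)) (abs_nonneg _) zero_le_one
      _ = _ := one_mul _

/-- A gradient step moves each neuron by at most a multiple of the norm of the residual. -/
lemma norm_objectiveGrad_le {m d n : ℕ} {x : Fin n → EuclideanSpace ℝ (Fin d)}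
    (hx : ∀ i, ‖x i‖ = 1) (u : EuclideanSpace ℝ (Fin n)) {a : Fin m → ℝ}
    (ha : ∀ r, a r = -1 ∨ a r = 1) (W : Fin m → EuclideanSpace ℝ (Fin d)) (r : Fin m) :
    ‖objectiveGrad x u a W r‖ ≤ √(n : ℝ) / √(m : ℝ) * ‖outputs x a W - u‖ := by
  have har : |a r| = 1 := by rcases ha r with h | h <;> rw [h] <;> norm_num
  have hsum : ‖∑ i, ((net a W (x i) - u i) * reluDeriv (inner ℝ (W r) (x i))) • x i‖ ≤
      √(n : ℝ) * ‖outputs x a W - u‖ := by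
    calc _ ≤ ∑ i, |(outputs x a W - u) i| * 1 := by
          refine (norm_sum_le _ _).trans (Finset.sum_le_sum fun i _ => ?_)
          rw [norm_smul, hx i, mul_one, Real.norm_eq_abs, abs_mul]
          refine mul_le_mul_of_nonneg_left ?_ (abs_nonneg _)
          rw [abs_of_nonneg (reluDeriv_nonneg _)]
          exact reluDeriv_le_one _
      _ ≤ √(∑ i, |(outputs x a W - u) i| ^ 2) * √(∑ _i : Fin n, (1 : ℝ) ^ 2) :=
          Real.sum_mul_le_sqrt_mul_sqrt _ _ _
      _ = √(n : ℝ) * ‖outputs x a W - u‖ := by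
          rw [EuclideanSpace.norm_eq, mul_comm]
          simp
  rw [objectiveGrad, norm_smul, norm_div, Real.norm_eq_abs, har, Real.norm_of_nonneg
    (Real.sqrt_nonneg _), div_mul_eq_mul_div, div_mul_eq_mul_div, one_mul]
  gcongr

/-! ### Matrix norms and eigenbases -/

/-- The Frobenius norm bounds the operator norm. -/
lemma norm_toEuclideanLin_le {n : ℕ} (M : Matrix (Fin n) (Fin n) ℝ) (z : EuclideanSpace ℝ (Fin n)) :
    ‖M.toEuclideanLin z‖ ≤ √(∑ i, ∑ j, M i j ^ 2) * ‖z‖ := by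
  have h0 : 0 ≤ ∑ i, ∑ j, M i j ^ 2 :=
    Finset.sum_nonneg fun i _ => Finset.sum_nonneg fun j _ => sq_nonneg _
  rw [EuclideanSpace.norm_eq, EuclideanSpace.norm_eq, ← Real.sqrt_mul h0, Finset.sum_mul]
  refine Real.sqrt_le_sqrt (Finset.sum_le_sum fun i _ => ?_)
  simp only [Real.norm_eq_abs, sq_abs]
  exact Finset.sum_mul_sq_le_sq_mul_sq Finset.univ (fun j => M i j) fun j => z j

/-- The Frobenius norm is at most the sum of the absolute entries, and the double sum of `s i + s j`
is `2 * n * ∑ i, s i`. -/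
lemma norm_toEuclideanLin_le_of_abs_le {n : ℕ} {M : Matrix (Fin n) (Fin n) ℝ}
    {s : Fin n → ℝ} (hs : ∀ i, 0 ≤ s i) (hM : ∀ i j, |M i j| ≤ s i + s j)
    (z : EuclideanSpace ℝ (Fin n)) :
    ‖M.toEuclideanLin z‖ ≤ 2 * n * (∑ i, s i) * ‖z‖ := by
  refine (norm_toEuclideanLin_le M z).trans (mul_le_mul_of_nonneg_right ?_ (norm_nonneg _))
  have h0 : ∀ p : Fin n × Fin n, 0 ≤ s p.1 + s p.2 := fun p => add_nonneg (hs _) (hs _)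
  have h1 : ∑ p : Fin n × Fin n, (s p.1 + s p.2) = 2 * n * ∑ i, s i := by
    rw [Fintype.sum_prod_type]
    simp only [Finset.sum_add_distrib, Finset.sum_const, Finset.card_univ, Fintype.card_fin,
      nsmul_eq_mul, ← Finset.mul_sum]
    ring
  rw [← h1]
  refine Real.sqrt_le_iff.2 ⟨Finset.sum_nonneg fun p _ => h0 p, ?_⟩
  rw [← Fintype.sum_prod_type' (f := fun i j => M i j ^ 2)]
  refine le_trans (Finset.sum_le_sum fun p _ => ?_)
    (Finset.sum_sq_le_sq_sum_of_nonneg fun p _ => h0 p)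
  rw [← sq_abs]
  exact pow_le_pow_left₀ (abs_nonneg _) (hM _ _) 2

section Eigenbasis

variable {n : ℕ} {T : Module.End ℝ (EuclideanSpace ℝ (Fin n))} {lam : Fin n → ℝ}
  {v : OrthonormalBasis (Fin n) ℝ (EuclideanSpace ℝ (Fin n))}

lemma inner_eigenbasis_apply (hv : ∀ i, T (v i) = lam i • v i) (i : Fin n)
    (z : EuclideanSpace ℝ (Fin n)) : inner ℝ (v i) (T z) = lam i * inner ℝ (v i) z := by
  conv_lhs => rw [← v.sum_repr' z, map_sum, inner_sum]
  rw [Finset.sum_eq_single i]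
  · rw [map_smul, hv, inner_smul_right, inner_smul_right, real_inner_self_eq_norm_sq,
      v.norm_eq_one]
    ring
  · intro j _ hj
    rw [map_smul, hv, inner_smul_right, inner_smul_right, v.inner_eq_zero hj.symm]
    ring
  · simp

lemma inner_eigenbasis_pow_apply (hv : ∀ i, T (v i) = lam i • v i) (η : ℝ) (i : Fin n) (t : ℕ)
    (z : EuclideanSpace ℝ (Fin n)) :
    inner ℝ (v i) (((1 - η • T) ^ t) z) = (1 - η * lam i) ^ t * inner ℝ (v i) z := by
  induction t with
  | zero => simp
  | succ t ih =>
    rw [pow_succ', Module.End.mul_apply, LinearMap.sub_apply, Module.End.one_apply,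
      LinearMap.smul_apply, inner_sub_right, inner_smul_right, inner_eigenbasis_apply hv, ih]
    ring

lemma norm_pow_apply_eq (hv : ∀ i, T (v i) = lam i • v i) (η : ℝ) (t : ℕ)
    (z : EuclideanSpace ℝ (Fin n)) :
    ‖((1 - η • T) ^ t) z‖ = √(∑ i, inner ℝ (v i) z ^ 2 * (1 - η * lam i) ^ (2 * t)) := by
  rw [← Real.sqrt_sq (norm_nonneg (((1 - η • T) ^ t) z)), ← v.sum_sq_inner_right]
  refine congrArg _ (Finset.sum_congr rfl fun i _ => ?_)
  rw [inner_eigenbasis_pow_apply hv]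
  ring

/-- All factors `1 - η * lam i` are nonnegative, so the largest in absolute value belongs to the
smallest eigenvalue. -/
lemma norm_one_sub_apply_le (hv : ∀ i, T (v i) = lam i • v i) {η lam₀ : ℝ} (hη : 0 ≤ η)
    (hlam₀ : ∀ i, lam₀ ≤ lam i) (hlam : ∀ i, η * lam i ≤ 1) (hlam₀1 : η * lam₀ ≤ 1)
    (z : EuclideanSpace ℝ (Fin n)) : ‖z - η • T z‖ ≤ (1 - η * lam₀) * ‖z‖ := by
  have h := norm_pow_apply_eq hv η 1 z
  rw [pow_one, LinearMap.sub_apply, Module.End.one_apply, LinearMap.smul_apply] at h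
  rw [h]
  refine Real.sqrt_le_iff.2 ⟨mul_nonneg (by linarith) (norm_nonneg _), ?_⟩
  rw [mul_pow, ← v.sum_sq_inner_right z, Finset.mul_sum]
  refine Finset.sum_le_sum fun i _ => ?_
  rw [mul_comm, mul_one]
  refine mul_le_mul_of_nonneg_right ?_ (sq_nonneg _)
  have := mul_le_mul_of_nonneg_left (hlam₀ i) hη
  have := hlam i
  exact pow_le_pow_left₀ (by linarith) (by linarith) 2

end Eigenbasis

/-! ### Gradient descent stays close to the linearized dynamics -/

/-- Gradient descent on fixed labels, started near the initialization `W₀`: the weights stay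
within `R₀ + 2 A / lam₀ * ‖residual‖` of `W₀`, and the residual follows the kernel dynamics. -/
theorem gradientDescent_near_kernel {m d n : ℕ} {x : Fin n → EuclideanSpace ℝ (Fin d)}
    (hx : ∀ i, ‖x i‖ = 1) (u : EuclideanSpace ℝ (Fin n)) {a : Fin m → ℝ}
    (ha : ∀ r, a r = -1 ∨ a r = 1) {η R R₀ ρ lam₀ : ℝ} (hη : 0 < η) (hlam₀ : 0 < lam₀)
    (hηlam : η * lam₀ ≤ 1) (hρ0 : 0 ≤ ρ) (hρ : ρ ≤ lam₀ / 2)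
    {T : Module.End ℝ (EuclideanSpace ℝ (Fin n))}
    (hT : ∀ z, ‖z - η • T z‖ ≤ (1 - η * lam₀) * ‖z‖)
    {W₀ : Fin m → EuclideanSpace ℝ (Fin d)}
    (hG : ∀ G : Matrix (Fin n) (Fin n) ℝ, (∀ i j, |G i j - gram x W₀ i j| ≤
        nearKinkFraction R W₀ (x i) + nearKinkFraction R W₀ (x j)) →
      ∀ z, ‖G.toEuclideanLin z - T z‖ ≤ ρ * ‖z‖)
    {W : ℕ → Fin m → EuclideanSpace ℝ (Fin d)} {N : ℕ}
    (hW : ∀ t < N, ∀ r, W (t + 1) r = W t r - η • objectiveGrad x u a (W t) r)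
    (hW0 : ∀ r, ‖W 0 r - W₀ r‖ ≤ R₀)
    (hR : R₀ + √(n : ℝ) / √(m : ℝ) * (2 / lam₀) * ‖outputs x a (W 0) - u‖ ≤ R)
    (z₀ : EuclideanSpace ℝ (Fin n)) :
    ∀ t ≤ N, ‖outputs x a (W t) - u‖ ≤ ‖outputs x a (W 0) - u‖ ∧
      (∀ r, ‖W t r - W₀ r‖ ≤ R₀ + √(n : ℝ) / √(m : ℝ) * (2 / lam₀) *
        (‖outputs x a (W 0) - u‖ - ‖outputs x a (W t) - u‖)) ∧
      ‖(outputs x a (W t) - u) - ((1 - η • T) ^ t) z₀‖ ≤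
        ‖(outputs x a (W 0) - u) - z₀‖ +
          ρ * (2 / lam₀) * (‖outputs x a (W 0) - u‖ - ‖outputs x a (W t) - u‖) := by
  intro t
  set A : ℝ := √(n : ℝ) / √(m : ℝ) with hA
  have hA0 : 0 ≤ A := by positivity
  induction t with
  | zero => intro _; simpa using hW0
  | succ t ih =>
    intro ht
    obtain ⟨h1, h2, h3⟩ := ih (Nat.le_of_succ_le ht)
    set ζ := outputs x a (W t) - u with hζ
    set ζ₀ := outputs x a (W 0) - u with hζ₀
    have hstep : ∀ r, ‖W (t + 1) r - W t r‖ ≤ A * (η * ‖ζ‖) := by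
      intro r
      rw [hW t ht r, sub_sub_cancel_left, norm_neg, norm_smul, Real.norm_of_nonneg hη.le]
      have := mul_le_mul_of_nonneg_left (norm_objectiveGrad_le hx u ha (W t) r) hη.le
      calc _ ≤ _ := this
        _ = _ := by ring
    have hηle : η ≤ 2 / lam₀ := by
      rw [le_div_iff₀ hlam₀]; linarith
    have hcoef : 0 ≤ A * (2 / lam₀) := by positivity
    have hRt : ∀ r, ‖W t r - W₀ r‖ ≤ R := fun r => (h2 r).trans <| by
      have := mul_nonneg hcoef (norm_nonneg ζ)
      linarith
    have htri : ∀ r, ‖W (t + 1) r - W₀ r‖ ≤ A * (η * ‖ζ‖) + ‖W t r - W₀ r‖ := fun r =>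
      calc _ = ‖(W (t + 1) r - W t r) + (W t r - W₀ r)‖ := by rw [sub_add_sub_cancel]
        _ ≤ _ := (norm_add_le _ _).trans (by linarith [hstep r])
    -- The secant matrix needs both ends of the step within `R`, before any contraction of this step
    -- is known. The step length is charged to the part ‖ζ‖ of the budget not spent so far, using η
    -- ≤ 2/λ₀, which avoids circularity.
    have hRt' : ∀ r, ‖W (t + 1) r - W₀ r‖ ≤ R := fun r => (htri r).trans <| by
      have : A * (η * ‖ζ‖) ≤ A * (2 / lam₀ * ‖ζ‖) := by gcongr
      linarith [h2 r]
    obtain ⟨G, hGstep, hGclose⟩ := exists_step_matrix hx u ha (hW t ht) hRt hRt'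
    have hGT := hG G hGclose ζ
    set ζ' := outputs x a (W (t + 1)) - u with hζ'
    rw [← hζ] at hGstep
    clear_value ζ ζ' ζ₀
    have hdec : ζ' = (ζ - η • T ζ) - η • (G.toEuclideanLin ζ - T ζ) := by
      rw [hGstep, smul_sub]; abel
    have herr : ‖η • (G.toEuclideanLin ζ - T ζ)‖ ≤ η * (ρ * ‖ζ‖) := by
      rw [norm_smul, Real.norm_of_nonneg hη.le]
      exact mul_le_mul_of_nonneg_left hGT hη.le
    have hcontr : ‖ζ'‖ ≤ ‖ζ‖ - η * (lam₀ / 2) * ‖ζ‖ := by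
      rw [hdec]
      have h4 : η * (ρ * ‖ζ‖) ≤ η * (lam₀ / 2 * ‖ζ‖) := by gcongr
      have := norm_sub_le (ζ - η • T ζ) (η • (G.toEuclideanLin ζ - T ζ))
      linarith [hT ζ]
    -- This is the telescoping inequality: it turns the step size into a drop of the residual norm,
    -- and feeds both remaining bounds.
    have hgain : η * ‖ζ‖ ≤ 2 / lam₀ * (‖ζ‖ - ‖ζ'‖) := by
      rw [div_mul_eq_mul_div, le_div_iff₀ hlam₀]
      linarith
    refine ⟨?_, fun r => ?_, ?_⟩
    · have : 0 ≤ η * (lam₀ / 2) * ‖ζ‖ := by positivity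
      linarith
    · have := mul_le_mul_of_nonneg_left hgain hA0
      linarith [htri r, h2 r]
    · have hpow : ((1 - η • T) ^ (t + 1)) z₀ =
          ((1 - η • T) ^ t) z₀ - η • T (((1 - η • T) ^ t) z₀) := by
        rw [pow_succ', Module.End.mul_apply, LinearMap.sub_apply, Module.End.one_apply,
          LinearMap.smul_apply]
      -- The old discrepancy is contracted by 1 - ηT, and the step adds a new error of size at most
      -- ηρ‖ζ‖.
      have hdiff : ζ' - ((1 - η • T) ^ (t + 1)) z₀ =
          ((ζ - ((1 - η • T) ^ t) z₀) - η • T (ζ - ((1 - η • T) ^ t) z₀)) -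
            η • (G.toEuclideanLin ζ - T ζ) := by
        rw [hpow, hdec]; simp only [map_sub, smul_sub]; abel
      rw [hdiff]
      have h4 := norm_sub_le ((ζ - ((1 - η • T) ^ t) z₀) - η • T (ζ - ((1 - η • T) ^ t) z₀))
        (η • (G.toEuclideanLin ζ - T ζ))
      have h5 := hT (ζ - ((1 - η • T) ^ t) z₀)
      have h6 : 0 ≤ η * lam₀ * ‖ζ - ((1 - η • T) ^ t) z₀‖ := by positivity
      have h7 := mul_le_mul_of_nonneg_left hgain hρ0
      linarith

/-- Gradient descent first on `y`, then on `y'`. -/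
theorem abs_norm_residual_sub_le {m d n : ℕ} {x : Fin n → EuclideanSpace ℝ (Fin d)}
    (hx : ∀ i, ‖x i‖ = 1) (y y' : EuclideanSpace ℝ (Fin n)) {a : Fin m → ℝ}
    (ha : ∀ r, a r = -1 ∨ a r = 1) {η R ρ lam₀ B : ℝ} (hη : 0 < η) (hlam₀ : 0 < lam₀)
    (hηlam : η * lam₀ ≤ 1) (hρ0 : 0 ≤ ρ) (hρ : ρ ≤ lam₀ / 2)
    {T : Module.End ℝ (EuclideanSpace ℝ (Fin n))}
    (hT : ∀ z, ‖z - η • T z‖ ≤ (1 - η * lam₀) * ‖z‖)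
    {W₀ : Fin m → EuclideanSpace ℝ (Fin d)}
    (hG : ∀ G : Matrix (Fin n) (Fin n) ℝ, (∀ i j, |G i j - gram x W₀ i j| ≤
        nearKinkFraction R W₀ (x i) + nearKinkFraction R W₀ (x j)) →
      ∀ z, ‖G.toEuclideanLin z - T z‖ ≤ ρ * ‖z‖)
    (hB : ‖outputs x a W₀ - y‖ + (‖outputs x a W₀ - y‖ + ‖y - y'‖) ≤ B)
    (hR : √(n : ℝ) / √(m : ℝ) * (2 / lam₀) * B ≤ R) (k k' : ℕ) :
    |‖outputs x a (weights η x y y' k a W₀ (k + k')) - y'‖ -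
        ‖((1 - η • T) ^ k') (y - y' - ((1 - η • T) ^ k) y)‖| ≤
      ‖outputs x a W₀‖ + ρ * (2 / lam₀) * B := by
  have hcoef : 0 ≤ √(n : ℝ) / √(m : ℝ) * (2 / lam₀) := by positivity
  have hB1 : ‖outputs x a W₀ - y‖ ≤ B := by
    linarith [norm_nonneg (outputs x a W₀ - y), norm_nonneg (y - y')]
  -- The ideal trajectory starts at `-y`, the residual of a zero output, so the initial discrepancy
  -- is exactly the norm of the initial outputs.
  obtain ⟨p1, p2, p3⟩ := gradientDescent_near_kernel hx y ha hη hlam₀ hηlam hρ0 hρ hT hG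
    (W := weights η x y y' k a W₀) (N := k) (R₀ := 0)
    (fun t ht r => by simp only [weights, if_pos ht]) (fun r => by simp [weights])
    (by
      have := mul_le_mul_of_nonneg_left hB1 hcoef
      simp only [weights]; linarith) (-y) k le_rfl
  simp only [weights, zero_add] at p1 p2 p3
  set V := weights η x y y' k a W₀ k with hV
  have hres : ‖outputs x a V - y'‖ ≤ ‖outputs x a V - y‖ + ‖y - y'‖ := by
    rw [← sub_add_sub_cancel (outputs x a V) y y']
    exact norm_add_le _ _
  -- The residual left by the first phase cancels: the drop of that phase plus the new starting
  -- residual costs no more than the initial residual plus ‖y - y'‖.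
  have hsum : ‖outputs x a W₀ - y‖ - ‖outputs x a V - y‖ + ‖outputs x a V - y'‖ ≤ B := by
    linarith [norm_nonneg (outputs x a W₀ - y)]
  -- `R₀` is the displacement bound `p2` of the first phase. The ideal start is the zero-output
  -- prediction after `k` steps, `y - ((1 - η • T) ^ k) y`, minus `y'`.
  obtain ⟨_, _, q3⟩ := gradientDescent_near_kernel hx y' ha hη hlam₀ hηlam hρ0 hρ hT hG
    (W := fun t => weights η x y y' k a W₀ (k + t)) (N := k') (R₀ := _)
    (fun t _ r => by
      show weights η x y y' k a W₀ (k + t + 1) r = _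
      rw [weights, if_neg (by omega)]) p2
    (by
      have := mul_le_mul_of_nonneg_left hsum hcoef
      simp only [add_zero]; linarith) (y - y' - ((1 - η • T) ^ k) y) k' le_rfl
  simp only [add_zero, ← hV] at q3
  have hstart : (outputs x a V - y') - (y - y' - ((1 - η • T) ^ k) y) =
      (outputs x a V - y) - ((1 - η • T) ^ k) (-y) := by
    rw [map_neg]; abel
  rw [hstart] at q3
  rw [sub_neg_eq_add, sub_add_cancel] at p3
  refine (abs_norm_sub_norm_le _ _).trans ?_
  have hcoef' : 0 ≤ ρ * (2 / lam₀) := by positivity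
  have h1 := mul_le_mul_of_nonneg_left hsum hcoef'
  have h2 := mul_nonneg hcoef' (norm_nonneg (outputs x a (weights η x y y' k a W₀ (k + k')) - y'))
  linarith

/-! ### Moment bounds at initialization -/

/-- The law of one neuron at initialization. -/
noncomputable abbrev neuronLaw (d : ℕ) (κ : ℝ) : Measure (EuclideanSpace ℝ (Fin d)) :=
  multivariateGaussian 0 (κ ^ 2 • (1 : Matrix (Fin d) (Fin d) ℝ))

/-- The law of the first layer at initialization. -/
noncomputable abbrev layerLaw (m d : ℕ) (κ : ℝ) : Measure (Fin m → EuclideanSpace ℝ (Fin d)) :=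
  Measure.pi fun _ => neuronLaw d κ

/-- The law of the second layer. -/
noncomputable abbrev signLaw (m : ℕ) : Measure (Fin m → ℝ) :=
  Measure.pi fun _ => uniformOn {-1, 1}

section PiConst

variable {m : ℕ} {Ω : Type*} [MeasurableSpace Ω] {μ : Measure Ω} [IsProbabilityMeasure μ]
  {f : Ω → ℝ}

lemma integral_pi_const_eval (hf : AEStronglyMeasurable f μ) (r : Fin m) :
    ∫ W : Fin m → Ω, f (W r) ∂(Measure.pi fun _ => μ) = ∫ w, f w ∂μ :=
  integral_comp_eval (X := fun _ : Fin m => Ω) (μ := fun _ => μ) hf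

lemma memLp_pi_const_eval {p : ENNReal} (hf : MemLp f p μ) (r : Fin m) :
    MemLp (fun W : Fin m → Ω => f (W r)) p (Measure.pi fun _ => μ) :=
  hf.comp_measurePreserving (measurePreserving_eval (fun _ : Fin m => μ) r)

lemma integrable_pi_const_eval (hf : Integrable f μ) (r : Fin m) :
    Integrable (fun W : Fin m → Ω => f (W r)) (Measure.pi fun _ => μ) :=
  integrable_comp_eval (X := fun _ : Fin m => Ω) (μ := fun _ => μ) hf

end PiConst

/-- Markov's inequality for real-valued functions. -/
lemma measure_ge_le_of_integral_le {Ω : Type*} [MeasurableSpace Ω] {μ : Measure Ω}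
    [IsFiniteMeasure μ] {f : Ω → ℝ} (hf0 : 0 ≤ f) (hf : Integrable f μ) {C p c : ℝ} (hc : 0 < c)
    (hC : ∫ ω, f ω ∂μ ≤ C) (hCp : C ≤ c * p) : μ {ω | c ≤ f ω} ≤ ENNReal.ofReal p := by
  rw [← ofReal_measureReal (measure_ne_top _ _)]
  refine ENNReal.ofReal_le_ofReal ?_
  have := mul_meas_ge_le_integral_of_nonneg (ae_of_all μ hf0) hf c
  exact le_of_mul_le_mul_left (this.trans (hC.trans hCp)) hc

lemma measurable_nearKink {d : ℕ} (R : ℝ) (x : EuclideanSpace ℝ (Fin d)) :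
    Measurable fun w => nearKink R w x :=
  Measurable.ite (measurableSet_le (by fun_prop) (by fun_prop)) measurable_const measurable_const

lemma integrable_nearKink {d : ℕ} (κ R : ℝ) (x : EuclideanSpace ℝ (Fin d)) :
    Integrable (fun w => nearKink R w x) (neuronLaw d κ) := by
  refine Integrable.of_bound (measurable_nearKink R x).aestronglyMeasurable 1
    (ae_of_all _ fun w => ?_)
  unfold nearKink
  split_ifs <;> simp

lemma integral_nearKink_le {d : ℕ} {κ R : ℝ} (hκ : 0 < κ) (hR : 0 ≤ R)
    {x : EuclideanSpace ℝ (Fin d)} (hx : ‖x‖ = 1) :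
    ∫ w, nearKink R w x ∂(neuronLaw d κ) ≤ R / κ := by
  have hs : MeasurableSet {w : EuclideanSpace ℝ (Fin d) | |inner ℝ w x| ≤ R} :=
    measurableSet_le (by fun_prop) (by fun_prop)
  refine le_trans (le_of_eq ?_) (multivariateGaussian_abs_inner_le hκ hR hx)
  rw [← integral_indicator_one hs]
  exact integral_congr_ae (ae_of_all _ fun w => by simp [nearKink, Set.indicator])

lemma integrable_nearKinkFraction {m d : ℕ} (κ R : ℝ) (x : EuclideanSpace ℝ (Fin d)) :
    Integrable (fun W => nearKinkFraction R W x) (layerLaw m d κ) :=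
  (integrable_finsetSum _ fun r _ => integrable_pi_const_eval (integrable_nearKink κ R x) r).const_mul _

lemma integral_nearKinkFraction_le {m d : ℕ} (hm : 0 < m) {κ R : ℝ} (hκ : 0 < κ) (hR : 0 ≤ R)
    {x : EuclideanSpace ℝ (Fin d)} (hx : ‖x‖ = 1) :
    ∫ W, nearKinkFraction R W x ∂(layerLaw m d κ) ≤ R / κ := by
  have hm' : (0 : ℝ) < m := Nat.cast_pos.2 hm
  unfold nearKinkFraction
  rw [integral_const_mul, integral_finsetSum _ fun r _ =>
    integrable_pi_const_eval (integrable_nearKink κ R x) r]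
  calc _ ≤ 1 / (m : ℝ) * ∑ _r : Fin m, R / κ := by
        gcongr with r
        rw [integral_pi_const_eval (f := fun w => nearKink R w x)
          (measurable_nearKink R x).aestronglyMeasurable]
        exact integral_nearKink_le hκ hR hx
    _ = R / κ := by
        rw [Finset.sum_const, Finset.card_univ, Fintype.card_fin, nsmul_eq_mul]
        field_simp

section Gram

variable {n d : ℕ} {x : Fin n → EuclideanSpace ℝ (Fin d)}

lemma measurable_gram_summand (x : Fin n → EuclideanSpace ℝ (Fin d)) (i j : Fin n) :
    Measurable fun w : EuclideanSpace ℝ (Fin d) => inner ℝ (x i) (x j) *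
      (reluDeriv (inner ℝ w (x i)) * reluDeriv (inner ℝ w (x j))) := by
  have h : ∀ i, Measurable fun w : EuclideanSpace ℝ (Fin d) => reluDeriv (inner ℝ w (x i)) :=
    fun i => measurable_reluDeriv.comp (by fun_prop)
  exact ((h i).mul (h j)).const_mul _

lemma abs_gram_summand_le (hx : ∀ i, ‖x i‖ = 1) (i j : Fin n) (w : EuclideanSpace ℝ (Fin d)) :
    |inner ℝ (x i) (x j) * (reluDeriv (inner ℝ w (x i)) * reluDeriv (inner ℝ w (x j)))| ≤ 1 := by
  rw [abs_mul, abs_of_nonneg (mul_nonneg (reluDeriv_nonneg _) (reluDeriv_nonneg _))]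
  exact mul_le_one₀ (abs_inner_le_one (hx i) (hx j))
    (mul_nonneg (reluDeriv_nonneg _) (reluDeriv_nonneg _))
    (mul_le_one₀ (reluDeriv_le_one _) (reluDeriv_nonneg _) (reluDeriv_le_one _))

lemma abs_gramInf_le_one (hx : ∀ i, ‖x i‖ = 1) (i j : Fin n) : |gramInf x i j| ≤ 1 := by
  rw [← integral_reluDeriv_mul_eq_gramInf one_pos x i j, ← Real.norm_eq_abs]
  refine (norm_integral_le_of_norm_le_const (C := 1) (ae_of_all _ fun w => ?_)).trans (by simp)
  exact abs_gram_summand_le hx i j w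

lemma memLp_gram_summand (hx : ∀ i, ‖x i‖ = 1) (κ : ℝ) (i j : Fin n) :
    MemLp (fun w => inner ℝ (x i) (x j) *
      (reluDeriv (inner ℝ w (x i)) * reluDeriv (inner ℝ w (x j)))) 2 (neuronLaw d κ) :=
  MemLp.of_bound (measurable_gram_summand x i j).aestronglyMeasurable 1
    (ae_of_all _ fun w => abs_gram_summand_le hx i j w)

lemma memLp_gram_sub (hx : ∀ i, ‖x i‖ = 1) (m : ℕ) (κ : ℝ) (i j : Fin n) :
    MemLp (fun W => gram x W i j - gramInf x i j) 2 (layerLaw m d κ) := by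
  have h : MemLp (fun W : Fin m → EuclideanSpace ℝ (Fin d) => ∑ r, inner ℝ (x i) (x j) *
      (reluDeriv (inner ℝ (W r) (x i)) * reluDeriv (inner ℝ (W r) (x j)))) 2 (layerLaw m d κ) :=
    memLp_finsetSum _ fun r _ => memLp_pi_const_eval (memLp_gram_summand hx κ i j) r
  exact (h.const_mul _).sub (memLp_const _)

/-- The entry is an average of `m` independent variables with values in `[-1, 1]` and mean `gramInf
x i j`, and each has variance at most 1. -/
lemma integral_gram_sub_sq_le (hx : ∀ i, ‖x i‖ = 1) {m : ℕ} (hm : 0 < m) {κ : ℝ} (hκ : 0 < κ)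
    (i j : Fin n) :
    ∫ W, (gram x W i j - gramInf x i j) ^ 2 ∂(layerLaw m d κ) ≤ 1 / m := by
  have hm' : (0 : ℝ) < m := Nat.cast_pos.2 hm
  set X : EuclideanSpace ℝ (Fin d) → ℝ := fun w => inner ℝ (x i) (x j) *
      (reluDeriv (inner ℝ w (x i)) * reluDeriv (inner ℝ w (x j))) with hX
  have hXm := measurable_gram_summand x i j
  have hXL := memLp_gram_summand hx κ i j
  have hgram : (fun W : Fin m → EuclideanSpace ℝ (Fin d) => gram x W i j) =
      fun W => 1 / (m : ℝ) * (∑ r, fun W : Fin m → EuclideanSpace ℝ (Fin d) => X (W r)) W := by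
    funext W
    simp [gram, hX]
  have hXr : ∀ r : Fin m, MemLp (fun W : Fin m → EuclideanSpace ℝ (Fin d) => X (W r)) 2
      (layerLaw m d κ) := fun r => memLp_pi_const_eval hXL r
  have hmean : ∫ W, gram x W i j ∂(layerLaw m d κ) = gramInf x i j := by
    simp only [gram, Matrix.of_apply]
    rw [integral_const_mul, integral_finsetSum _ fun r _ => (hXr r).integrable one_le_two]
    have : ∀ r : Fin m, ∫ W, X (W r) ∂(layerLaw m d κ) = gramInf x i j := fun r => by
      rw [integral_pi_const_eval (f := X) hXm.aestronglyMeasurable]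
      exact integral_reluDeriv_mul_eq_gramInf hκ x i j
    rw [Finset.sum_congr rfl fun r _ => this r, Finset.sum_const, Finset.card_univ,
      Fintype.card_fin, nsmul_eq_mul]
    field_simp
  have haem : AEMeasurable (fun W => gram x W i j) (layerLaw m d κ) := by
    rw [hgram]
    exact ((memLp_finsetSum' _ fun r _ => hXr r).aestronglyMeasurable.aemeasurable).const_mul _
  have hvar := variance_eq_integral haem
  rw [hmean] at hvar
  rw [← hvar, hgram, variance_const_mul, variance_sum_pi fun _ => hXL]
  have h1 : Var[X; neuronLaw d κ] ≤ 1 := by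
    have := variance_le_sq_of_bounded (μ := neuronLaw d κ) (X := X) (a := -1) (b := 1)
      (ae_of_all _ fun w => abs_le.1 (abs_gram_summand_le hx i j w)) hXm.aemeasurable
    norm_num at this
    exact this
  calc _ ≤ (1 / (m : ℝ)) ^ 2 * ∑ _r : Fin m, (1 : ℝ) := by gcongr
    _ = 1 / m := by
        rw [Finset.sum_const, Finset.card_univ, Fintype.card_fin, nsmul_eq_mul]
        field_simp

end Gram

/-- The second moment of a linear combination of random signs. -/
lemma lintegral_sum_sign_mul_sq {m : ℕ} (b : Fin m → ℝ) :
    ∫⁻ a, ENNReal.ofReal ((∑ r, a r * b r) ^ 2) ∂(signLaw m) =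
      ∑ r, ENNReal.ofReal (b r ^ 2) := by
  have hL : ∀ r, MemLp (fun t : ℝ => t * b r) 2 (uniformOn ({-1, 1} : Set ℝ)) :=
    fun r => memLp_sign.mul_const _
  have hLr : ∀ r : Fin m, MemLp (fun a : Fin m → ℝ => a r * b r) 2 (signLaw m) :=
    fun r => memLp_pi_const_eval (hL r) r
  have hsum : (fun a : Fin m → ℝ => ∑ r, a r * b r) = ∑ r, fun a : Fin m → ℝ => a r * b r := by
    funext a; simp
  have hS : MemLp (fun a : Fin m → ℝ => ∑ r, a r * b r) 2 (signLaw m) :=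
    memLp_finsetSum _ fun r _ => hLr r
  have hmean : ∫ a, ∑ r, a r * b r ∂(signLaw m) = 0 := by
    rw [integral_finsetSum _ fun r _ => (hLr r).integrable one_le_two]
    refine Finset.sum_eq_zero fun r _ => ?_
    rw [integral_pi_const_eval (f := fun t : ℝ => t * b r) (by fun_prop), integral_mul_const,
      integral_sign, zero_mul]
  rw [← ofReal_integral_eq_lintegral_ofReal hS.integrable_sq (ae_of_all _ fun a => sq_nonneg _),
    ← variance_of_integral_eq_zero hS.aestronglyMeasurable.aemeasurable hmean, hsum,
    variance_sum_pi hL, ← ENNReal.ofReal_sum_of_nonneg fun r _ => sq_nonneg _]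
  congr 1
  refine Finset.sum_congr rfl fun r _ => ?_
  rw [variance_mul_const, variance_sign, one_mul]

/-- Integrating over the signs first removes the cross terms, and each remaining diagonal term
contributes at most κ²/m. Working with `∫⁻` lets Tonelli apply without integrability conditions. -/
lemma lintegral_net_sq_le {m d : ℕ} {κ : ℝ} (hκ : 0 < κ)
    {x : EuclideanSpace ℝ (Fin d)} (hx : ‖x‖ = 1) :
    ∫⁻ ω, ENNReal.ofReal (net ω.2 ω.1 x ^ 2) ∂(initLaw m d κ) ≤ ENNReal.ofReal (κ ^ 2) := by
  have hrelu : ∀ r : Fin m, Measurable fun W : Fin m → EuclideanSpace ℝ (Fin d) =>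
      relu (inner ℝ (W r) x) := fun r => measurable_relu.comp (by fun_prop)
  have hnet : Measurable fun ω : (Fin m → EuclideanSpace ℝ (Fin d)) × (Fin m → ℝ) =>
      net ω.2 ω.1 x :=
    (Finset.measurable_sum _ fun r _ => ((measurable_pi_apply r).comp measurable_snd).mul
      ((hrelu r).comp measurable_fst)).const_mul _
  have hinner : ∀ W : Fin m → EuclideanSpace ℝ (Fin d),
      ∫⁻ a, ENNReal.ofReal (net a W x ^ 2) ∂(signLaw m) =
        ENNReal.ofReal (1 / m) * ∑ r, ENNReal.ofReal (relu (inner ℝ (W r) x) ^ 2) := by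
    intro W
    rw [← lintegral_sum_sign_mul_sq, ← lintegral_const_mul' _ _ ENNReal.ofReal_ne_top]
    refine lintegral_congr fun a => ?_
    rw [← ENNReal.ofReal_mul (by positivity), net, mul_pow, div_pow, one_pow,
      Real.sq_sqrt (Nat.cast_nonneg m)]
  rw [initLaw, lintegral_prod _ (hnet.pow_const 2).ennreal_ofReal.aemeasurable]
  simp only [hinner]
  rw [lintegral_const_mul' _ _ ENNReal.ofReal_ne_top, lintegral_finsetSum _ fun r _ =>
    ((hrelu r).pow_const 2).ennreal_ofReal]
  calc _ ≤ ENNReal.ofReal (1 / m) * ∑ _r : Fin m, ENNReal.ofReal (κ ^ 2) := by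
        gcongr with r
        have hmp := measurePreserving_eval (fun _ : Fin m => neuronLaw d κ) r
        have := hmp.lintegral_comp (f := fun w => ENNReal.ofReal (relu (inner ℝ w x) ^ 2))
          ((measurable_relu.comp (by fun_prop)).pow_const 2).ennreal_ofReal
        refine this.trans_le ?_
        exact lintegral_relu_inner_sq_le hκ hx
    _ ≤ ENNReal.ofReal (κ ^ 2) := by
        rw [← ENNReal.ofReal_sum_of_nonneg fun _ _ => sq_nonneg _,
          ← ENNReal.ofReal_mul (by positivity)]
        refine ENNReal.ofReal_le_ofReal ?_
        rw [Finset.sum_const, Finset.card_univ, Fintype.card_fin, nsmul_eq_mul, ← mul_assoc]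
        -- An inequality is used since `1 / m * m` is 0 when `m = 0`.
        refine mul_le_of_le_one_left (sq_nonneg _) ?_
        rw [one_div]
        exact inv_mul_le_one

/-! ### Typical initializations and their probability -/

/-- The event that the initialization is typical: signs are signs, the initial outputs are small,
few neurons are near a kink, and the Gram matrix is near its expectation. -/
def TypicalInit {m d n : ℕ} (x : Fin n → EuclideanSpace ℝ (Fin d)) (κ R δ : ℝ)
    (ω : (Fin m → EuclideanSpace ℝ (Fin d)) × (Fin m → ℝ)) : Prop :=
  (∀ r, ω.2 r = -1 ∨ ω.2 r = 1) ∧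
  ‖outputs x ω.2 ω.1‖ ^ 2 ≤ 3 * (n * κ ^ 2) / δ ∧
  ∑ i, nearKinkFraction R ω.1 (x i) ≤ 3 * (n * (R / κ)) / δ ∧
  ∑ i, ∑ j, (gram x ω.1 i j - gramInf x i j) ^ 2 ≤ 3 * ((n : ℝ) ^ 2 / m) / δ

section Typical

variable {m d n : ℕ} {x : Fin n → EuclideanSpace ℝ (Fin d)} {κ R δ : ℝ}

instance : IsProbabilityMeasure (initLaw m d κ) := by
  unfold initLaw; infer_instance

lemma norm_outputs_sq (a : Fin m → ℝ) (W : Fin m → EuclideanSpace ℝ (Fin d)) :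
    ‖outputs x a W‖ ^ 2 = ∑ i, net a W (x i) ^ 2 := by
  simp [outputs, EuclideanSpace.norm_sq_eq]

lemma measure_outputs_ge_le (hx : ∀ i, ‖x i‖ = 1) (hn : 0 < n) (hκ : 0 < κ) (hδ : 0 < δ) :
    initLaw m d κ {ω | 3 * (n * κ ^ 2) / δ ≤ ‖outputs x ω.2 ω.1‖ ^ 2} ≤
      ENNReal.ofReal (δ / 3) := by
  have hn' : (0 : ℝ) < n := Nat.cast_pos.2 hn
  have hnet : ∀ i, Measurable fun ω : (Fin m → EuclideanSpace ℝ (Fin d)) × (Fin m → ℝ) =>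
      net ω.2 ω.1 (x i) := fun i =>
    (Finset.measurable_sum _ fun r _ => ((measurable_pi_apply r).comp measurable_snd).mul
      (measurable_relu.comp (by fun_prop))).const_mul _
  have hc : 0 < 3 * (n * κ ^ 2) / δ := by positivity
  have hint : ∫⁻ ω, ENNReal.ofReal (∑ i, net ω.2 ω.1 (x i) ^ 2) ∂(initLaw m d κ) ≤
      ENNReal.ofReal (n * κ ^ 2) := by
    simp only [ENNReal.ofReal_sum_of_nonneg fun i _ => sq_nonneg _]
    rw [lintegral_finsetSum _ fun i _ => ((hnet i).pow_const 2).ennreal_ofReal]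
    refine (Finset.sum_le_sum fun i _ => lintegral_net_sq_le hκ (hx i)).trans (le_of_eq ?_)
    rw [← ENNReal.ofReal_sum_of_nonneg fun _ _ => sq_nonneg _]
    simp
  have hmarkov := meas_ge_le_lintegral_div (μ := initLaw m d κ)
    (f := fun ω => ENNReal.ofReal (∑ i, net ω.2 ω.1 (x i) ^ 2))
    (Finset.measurable_sum _ fun i _ => (hnet i).pow_const 2).ennreal_ofReal.aemeasurable
    (ENNReal.ofReal_pos.2 hc).ne' ENNReal.ofReal_ne_top
  refine le_trans (measure_mono fun ω hω => ?_) (hmarkov.trans ?_)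
  · rw [Set.mem_ofPred_eq, norm_outputs_sq] at hω
    exact ENNReal.ofReal_le_ofReal hω
  · refine (ENNReal.div_le_div_right hint _).trans (le_of_eq ?_)
    rw [← ENNReal.ofReal_div_of_pos hc]
    congr 1
    field_simp

lemma measure_nearKinkFraction_ge_le (hx : ∀ i, ‖x i‖ = 1) (hn : 0 < n) (hm : 0 < m)
    (hκ : 0 < κ) (hR : 0 < R) (hδ : 0 < δ) :
    layerLaw m d κ {W | 3 * (n * (R / κ)) / δ ≤ ∑ i, nearKinkFraction R W (x i)} ≤
      ENNReal.ofReal (δ / 3) := by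
  have hn' : (0 : ℝ) < n := Nat.cast_pos.2 hn
  have hI := fun i => integrable_nearKinkFraction (m := m) κ R (x i)
  refine measure_ge_le_of_integral_le (C := n * (R / κ))
    (fun W => Finset.sum_nonneg fun i _ => nearKinkFraction_nonneg _ _ _)
    (integrable_finsetSum _ fun i _ => hI i) (by positivity) ?_ (le_of_eq (by field_simp))
  rw [integral_finsetSum _ fun i _ => hI i]
  refine (Finset.sum_le_sum fun i _ => integral_nearKinkFraction_le hm hκ hR.le (hx i)).trans ?_
  simp

lemma measure_gram_sub_ge_le (hx : ∀ i, ‖x i‖ = 1) (hn : 0 < n) (hm : 0 < m)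
    (hκ : 0 < κ) (hδ : 0 < δ) :
    layerLaw m d κ {W | 3 * ((n : ℝ) ^ 2 / m) / δ ≤
      ∑ i, ∑ j, (gram x W i j - gramInf x i j) ^ 2} ≤ ENNReal.ofReal (δ / 3) := by
  have hn' : (0 : ℝ) < n := Nat.cast_pos.2 hn
  have hm' : (0 : ℝ) < m := Nat.cast_pos.2 hm
  have hI := fun i j => (memLp_gram_sub hx m κ i j).integrable_sq
  refine measure_ge_le_of_integral_le (C := (n : ℝ) ^ 2 / m)
    (fun W => Finset.sum_nonneg fun i _ => Finset.sum_nonneg fun j _ => sq_nonneg _)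
    (integrable_finsetSum _ fun i _ => integrable_finsetSum _ fun j _ => hI i j)
    (by positivity) ?_ (le_of_eq (by field_simp))
  rw [integral_finsetSum _ fun i _ => integrable_finsetSum _ fun j _ => hI i j]
  calc _ ≤ ∑ _i : Fin n, ∑ _j : Fin n, 1 / (m : ℝ) := Finset.sum_le_sum fun i _ => by
        rw [integral_finsetSum _ fun j _ => hI i j]
        exact Finset.sum_le_sum fun j _ => integral_gram_sub_sq_le hx hm hκ i j
    _ = (n : ℝ) ^ 2 / m := by
        simp only [Finset.sum_const, Finset.card_univ, Fintype.card_fin, nsmul_eq_mul]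
        ring

lemma ae_signs (m : ℕ) : ∀ᵐ a ∂(signLaw m), ∀ r, a r = -1 ∨ a r = 1 :=
  Filter.eventually_all.2 fun r =>
    (measurePreserving_eval (fun _ : Fin m => uniformOn ({-1, 1} : Set ℝ)) r).quasiMeasurePreserving.ae
      ae_sign

/-- A union bound over three Markov events of level δ/3 and the null event that some `a r` is not a
sign. Two of the events depend on the first layer alone, so their probability is computed under
`layerLaw`. -/
theorem measure_not_typicalInit_le (hx : ∀ i, ‖x i‖ = 1) (hn : 0 < n) (hm : 0 < m)
    (hκ : 0 < κ) (hR : 0 < R) (hδ : 0 < δ) :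
    initLaw m d κ {ω | ¬ TypicalInit x κ R δ ω} ≤ ENNReal.ofReal δ := by
  have hfst : ∀ s : Set (Fin m → EuclideanSpace ℝ (Fin d)),
      initLaw m d κ (Prod.fst ⁻¹' s) = layerLaw m d κ s := fun s => by
    rw [← Set.prod_univ, initLaw, Measure.prod_prod, measure_univ, mul_one]
  have hsnd : initLaw m d κ (Prod.snd ⁻¹' {a | ¬ ∀ r, a r = -1 ∨ a r = 1}) = 0 := by
    rw [← Set.univ_prod, initLaw, Measure.prod_prod, ae_iff.1 (ae_signs m), mul_zero]
  have hsub : {ω : (Fin m → EuclideanSpace ℝ (Fin d)) × (Fin m → ℝ) |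
      ¬ TypicalInit x κ R δ ω} ⊆
      (Prod.snd ⁻¹' {a | ¬ ∀ r, a r = -1 ∨ a r = 1}) ∪
      ({ω | 3 * (n * κ ^ 2) / δ ≤ ‖outputs x ω.2 ω.1‖ ^ 2} ∪
      ((Prod.fst ⁻¹' {W | 3 * (n * (R / κ)) / δ ≤ ∑ i, nearKinkFraction R W (x i)}) ∪
      (Prod.fst ⁻¹' {W | 3 * ((n : ℝ) ^ 2 / m) / δ ≤
        ∑ i, ∑ j, (gram x W i j - gramInf x i j) ^ 2}))) := by
    intro ω hω
    by_contra hcon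
    simp only [Set.mem_union, Set.mem_preimage, Set.mem_ofPred_eq, not_or, not_not, not_le] at hcon
    exact hω ⟨hcon.1, hcon.2.1.le, hcon.2.2.1.le, hcon.2.2.2.le⟩
  refine (measure_mono hsub).trans ?_
  refine (measure_union_le _ _).trans ?_
  rw [hsnd, zero_add]
  refine (measure_union_le _ _).trans ?_
  refine (add_le_add (measure_outputs_ge_le hx hn hκ hδ) ((measure_union_le _ _).trans
    (add_le_add ((hfst _).trans_le (measure_nearKinkFraction_ge_le hx hn hm hκ hR hδ))
      ((hfst _).trans_le (measure_gram_sub_ge_le hx hn hm hκ hδ))))).trans (le_of_eq ?_)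
  rw [← ENNReal.ofReal_add (by positivity) (by positivity),
    ← ENNReal.ofReal_add (by positivity) (by positivity)]
  congr 1
  ring

end Typical

/-! ### Deterministic error bound from a typical initialization -/

/-- The eigenvalues of the Gram matrix are at most the number of samples. -/
lemma abs_eigenvalue_gramInf_le {n d : ℕ} {x : Fin n → EuclideanSpace ℝ (Fin d)}
    (hx : ∀ i, ‖x i‖ = 1) {c : ℝ} {w : EuclideanSpace ℝ (Fin n)} (hw : ‖w‖ = 1)
    (h : (gramInf x).toEuclideanLin w = c • w) : |c| ≤ n := by
  have h1 := norm_toEuclideanLin_le (gramInf x) w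
  rw [h, norm_smul, hw, mul_one, mul_one, Real.norm_eq_abs] at h1
  refine h1.trans (Real.sqrt_le_iff.2 ⟨Nat.cast_nonneg n, ?_⟩)
  calc _ ≤ ∑ _i : Fin n, ∑ _j : Fin n, (1 : ℝ) :=
        Finset.sum_le_sum fun i _ => Finset.sum_le_sum fun j _ =>
          (sq_le_one_iff_abs_le_one _).2 (abs_gramInf_le_one hx i j)
    _ = (n : ℝ) ^ 2 := by simp [pow_two]

lemma norm_le_sqrt_of_abs_le_one {n : ℕ} {z : EuclideanSpace ℝ (Fin n)} (hz : ∀ i, |z i| ≤ 1) :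
    ‖z‖ ≤ √(n : ℝ) := by
  rw [EuclideanSpace.norm_eq]
  refine Real.sqrt_le_sqrt ?_
  calc _ ≤ ∑ _i : Fin n, (1 : ℝ) := Finset.sum_le_sum fun i _ => by
        rw [Real.norm_eq_abs, sq_abs]
        exact (sq_le_one_iff_abs_le_one _).2 (hz i)
    _ = n := by simp

/-- From a typical initialization, any matrix within the kink fractions of the initial Gram
matrix acts almost like `gramInf`. -/
lemma norm_sub_gramInf_le {m d n : ℕ} {x : Fin n → EuclideanSpace ℝ (Fin d)}
    {W₀ : Fin m → EuclideanSpace ℝ (Fin d)} {R α β : ℝ}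
    (hα : ∑ i, nearKinkFraction R W₀ (x i) ≤ α)
    (hβ : ∑ i, ∑ j, (gram x W₀ i j - gramInf x i j) ^ 2 ≤ β ^ 2) (hβ0 : 0 ≤ β)
    {G : Matrix (Fin n) (Fin n) ℝ} (hG : ∀ i j, |G i j - gram x W₀ i j| ≤
        nearKinkFraction R W₀ (x i) + nearKinkFraction R W₀ (x j))
    (z : EuclideanSpace ℝ (Fin n)) :
    ‖G.toEuclideanLin z - (gramInf x).toEuclideanLin z‖ ≤ (2 * n * α + β) * ‖z‖ := by
  have hsplit : G.toEuclideanLin z - (gramInf x).toEuclideanLin z =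
      (G - gram x W₀).toEuclideanLin z + (gram x W₀ - gramInf x).toEuclideanLin z := by
    rw [map_sub, map_sub, LinearMap.sub_apply, LinearMap.sub_apply, sub_add_sub_cancel]
  have h1 := norm_toEuclideanLin_le_of_abs_le (M := G - gram x W₀)
    (fun i => nearKinkFraction_nonneg R W₀ (x i)) hG z
  have h2 := norm_toEuclideanLin_le (gram x W₀ - gramInf x) z
  have h3 : √(∑ i, ∑ j, (gram x W₀ - gramInf x) i j ^ 2) ≤ β := Real.sqrt_le_iff.2 ⟨hβ0, hβ⟩
  have h4 : 2 * (n : ℝ) * (∑ i, nearKinkFraction R W₀ (x i)) ≤ 2 * n * α := by gcongr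
  rw [hsplit, add_mul]
  exact (norm_add_le _ _).trans (add_le_add
    (h1.trans (mul_le_mul_of_nonneg_right h4 (norm_nonneg _)))
    (h2.trans (mul_le_mul_of_nonneg_right h3 (norm_nonneg _))))

/-- From a typical initialization, the final residual is within `ε` of its prediction. -/
theorem abs_residual_sub_le_of_typicalInit {n d m : ℕ}
    {x : Fin n → EuclideanSpace ℝ (Fin d)} (hx : ∀ i, ‖x i‖ = 1)
    {y : EuclideanSpace ℝ (Fin n)} (hy : ∀ i, |y i| ≤ 1)
    {y' : EuclideanSpace ℝ (Fin n)} (hy' : ∀ i, y' i = 1 ∨ y' i = -1)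
    {lam : Fin n → ℝ} {v : OrthonormalBasis (Fin n) ℝ (EuclideanSpace ℝ (Fin n))}
    (hv : ∀ i, (gramInf x).toEuclideanLin (v i) = lam i • v i)
    {lam₀ : ℝ} (hleast : IsLeast (Set.range lam) lam₀) (hlam₀ : 0 < lam₀)
    {ε δ κ η : ℝ} (hδ : 0 < δ) (hδ1 : δ ≤ 1) (hε : 0 < ε) (hκ : 0 < κ) (hκ1 : κ ≤ 1)
    (hκε : κ ≤ 1 / 4 * (ε * √δ * lam₀ / (n : ℝ) ^ (3 / 2 : ℝ)))
    (hn : 0 < n) (hm : 0 < m)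
    (hm1 : 10 ^ 8 * ((n : ℝ) ^ 9 / (lam₀ ^ 6 * ε ^ 2 * κ ^ 2 * δ ^ 4)) ≤ (m : ℝ))
    (hm2 : 10 ^ 8 * ((n : ℝ) ^ 6 / (lam₀ ^ 4 * κ ^ 2 * δ ^ 3)) ≤ (m : ℝ))
    (hη : 0 < η) (hηle : η ≤ lam₀ / (n : ℝ) ^ 2) (k k' : ℕ)
    {ω : (Fin m → EuclideanSpace ℝ (Fin d)) × (Fin m → ℝ)}
    (hω : TypicalInit x κ (16 * n / (√m * √δ * lam₀)) δ ω) :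
    |‖outputs x ω.2 (weights η x y y' k ω.2 ω.1 (k + k')) - y'‖
      - √(∑ i, (inner ℝ (v i) y - inner ℝ (v i) y'
        - (1 - η * lam i) ^ k * inner ℝ (v i) y) ^ 2 * (1 - η * lam i) ^ (2 * k'))| ≤ ε := by
  obtain ⟨ha, hout, hkink, hgram⟩ := hω
  have hn0 : (0 : ℝ) < n := Nat.cast_pos.2 hn
  have hn1 : (1 : ℝ) ≤ n := Nat.one_le_cast.2 hn
  have hm0 : (0 : ℝ) < m := Nat.cast_pos.2 hm
  -- Naming the square roots of `δ`, `m` and `n` makes all later comparisons of constants rational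
  -- in `D`, `M` and `N`.
  obtain ⟨D, hD0, hD⟩ : ∃ D : ℝ, 0 < D ∧ √δ = D := ⟨_, Real.sqrt_pos.2 hδ, rfl⟩
  obtain ⟨M, hM0, hM⟩ : ∃ M : ℝ, 0 < M ∧ √(m : ℝ) = M := ⟨_, Real.sqrt_pos.2 hm0, rfl⟩
  obtain ⟨N, hN0, hN⟩ : ∃ N : ℝ, 0 < N ∧ √(n : ℝ) = N := ⟨_, Real.sqrt_pos.2 hn0, rfl⟩
  have hDsq : δ = D ^ 2 := by rw [← hD, Real.sq_sqrt hδ.le]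
  have hMsq : (m : ℝ) = M ^ 2 := by rw [← hM, Real.sq_sqrt hm0.le]
  have hNsq : (n : ℝ) = N ^ 2 := by rw [← hN, Real.sq_sqrt hn0.le]
  have hpow : (n : ℝ) ^ (3 / 2 : ℝ) = N ^ 3 := by
    rw [← hN, Real.sqrt_eq_rpow, ← Real.rpow_natCast, ← Real.rpow_mul hn0.le]
    norm_num
  have hD1 : D ≤ 1 := by rw [← hD]; exact Real.sqrt_le_one.2 hδ1
  have hN1 : 1 ≤ N := by rw [← hN]; exact Real.one_le_sqrt.2 hn1
  -- the spectrum
  have hlamn : ∀ i, |lam i| ≤ n := fun i => abs_eigenvalue_gramInf_le hx (v.norm_eq_one i) (hv i)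
  have hlam₀n : lam₀ ≤ n := by
    obtain ⟨i, hi⟩ := hleast.1
    rw [← hi]
    exact (le_abs_self _).trans (hlamn i)
  -- This is what the learning-rate condition is for: every eigenvalue is at most `n`, so all
  -- factors `1 - η * lam i` are nonnegative.
  have hηlam : ∀ c ≤ (n : ℝ), η * c ≤ 1 := fun c hc => by
    calc η * c ≤ lam₀ / (n : ℝ) ^ 2 * n := by
          refine (mul_le_mul_of_nonneg_left hc hη.le).trans ?_
          gcongr
      _ = lam₀ / n := by field_simp
      _ ≤ 1 := (div_le_one hn0).2 hlam₀n
  have hT := norm_one_sub_apply_le (T := (gramInf x).toEuclideanLin) hv hη.le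
    (fun i => hleast.2 ⟨i, rfl⟩) (fun i => hηlam _ ((le_abs_self _).trans (hlamn i)))
    (hηlam _ hlam₀n)
  -- norms
  have hout' : ‖outputs x ω.2 ω.1‖ ≤ 2 * κ * N / D := by
    refine abs_le_of_sq_le_sq' (hout.trans ?_) (by positivity) |>.2
    rw [hDsq, hNsq, div_pow]
    gcongr
    nlinarith [sq_nonneg (N * κ)]
  have hyN : ‖y‖ ≤ N := hN ▸ norm_le_sqrt_of_abs_le_one hy
  have hyN' : ‖y'‖ ≤ N := hN ▸ norm_le_sqrt_of_abs_le_one fun i => by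
    rcases hy' i with h | h <;> rw [h] <;> norm_num
  have hND : N ≤ N / D := (le_div_iff₀ hD0).2 (mul_le_of_le_one_right hN0.le hD1)
  have hκND : 2 * κ * N / D ≤ 2 * (N / D) := by
    rw [mul_assoc, mul_div_assoc, mul_div_assoc]
    have : κ * (N / D) ≤ N / D := mul_le_of_le_one_left (by positivity) hκ1
    linarith
  -- Each copy of the initial residual is at most 2N/D + N, and ‖y - y'‖ ≤ 2N; with N ≤ N/D this
  -- gives 3 + 3 + 2 = 8.
  have hB : ‖outputs x ω.2 ω.1 - y‖ + (‖outputs x ω.2 ω.1 - y‖ + ‖y - y'‖) ≤ 8 * (N / D) := by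
    linarith [norm_sub_le (outputs x ω.2 ω.1) y, norm_sub_le y y']
  -- closeness of the kernel
  have hG : ∀ G : Matrix (Fin n) (Fin n) ℝ, (∀ i j, |G i j - gram x ω.1 i j| ≤
        nearKinkFraction (16 * n / (√m * √δ * lam₀)) ω.1 (x i) +
          nearKinkFraction (16 * n / (√m * √δ * lam₀)) ω.1 (x j)) →
      ∀ z, ‖G.toEuclideanLin z - (gramInf x).toEuclideanLin z‖ ≤
        100 * N ^ 6 / (M * lam₀ * κ * D ^ 3) * ‖z‖ := by
    intro G hGc z
    refine (norm_sub_gramInf_le (β := 2 * N ^ 2 / (M * D)) hkink (hgram.trans ?_)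
      (by positivity) hGc z).trans (mul_le_mul_of_nonneg_right ?_ (norm_nonneg z))
    · rw [hMsq, hDsq, hNsq]
      have : (2 * N ^ 2 / (M * D)) ^ 2 = 4 * ((N ^ 2) ^ 2 / M ^ 2) / D ^ 2 := by
        field_simp; ring
      rw [this]
      gcongr
      norm_num
    -- The 100 in ρ covers 96 = 2 · 3 · 16 from the neurons near a kink and 2 from the fluctuation
    -- of the Gram matrix.
    · have h1 : 2 * (n : ℝ) * (3 * (n * (16 * n / (√m * √δ * lam₀) / κ)) / δ) =
          96 * N ^ 6 / (M * lam₀ * κ * D ^ 3) := by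
        rw [hM, hD, hDsq, hNsq]; field_simp; ring
      have h2 : 2 * N ^ 2 / (M * D) ≤ 2 * N ^ 6 / (M * lam₀ * κ * D ^ 3) := by
        rw [div_le_div_iff₀ (by positivity) (by positivity)]
        have h3 : lam₀ * κ * D ^ 2 ≤ N ^ 4 := by
          calc lam₀ * κ * D ^ 2 ≤ N ^ 2 * 1 * 1 ^ 2 := by
                rw [hNsq] at hlam₀n
                gcongr
            _ ≤ N ^ 4 := by
                rw [mul_one, one_pow, mul_one]
                exact pow_le_pow_right₀ hN1 (by norm_num)
        have := mul_le_mul_of_nonneg_left h3 (by positivity : 0 ≤ 2 * N ^ 2 * M * D)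
        linarith
      have h4 : 0 ≤ N ^ 6 / (M * lam₀ * κ * D ^ 3) := by positivity
      rw [h1]
      rw [mul_div_assoc 2 (N ^ 6)] at h2
      rw [mul_div_assoc 96, mul_div_assoc 100]
      linarith
  have hρ : 100 * N ^ 6 / (M * lam₀ * κ * D ^ 3) ≤ lam₀ / 2 := by
    -- This is the square root of the second width condition, which serves only to ensure ρ ≤ λ₀/2.
    have h1 : 10 ^ 4 * N ^ 6 ≤ M * lam₀ ^ 2 * κ * D ^ 3 := by
      refine abs_le_of_sq_le_sq' ?_ (by positivity) |>.2
      rw [hMsq, hDsq, hNsq, ← mul_div_assoc, div_le_iff₀ (by positivity)] at hm2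
      linarith
    rw [div_le_div_iff₀ (by positivity) (by positivity)]
    have : 0 < N ^ 6 := by positivity
    linarith
  -- The radius is the full displacement budget: √n/√m · (2/λ₀) · 8√n/√δ = 16n/(√m √δ λ₀).
  have hmain := abs_norm_residual_sub_le hx y y' ha hη hlam₀ (hηlam _ hlam₀n)
    (by positivity) hρ hT hG hB (le_of_eq (by
      rw [hN, hM, hD, hNsq]; field_simp; ring)) k k'
  rw [norm_pow_apply_eq hv] at hmain
  simp only [inner_sub_right, inner_eigenbasis_pow_apply hv] at hmain
  refine hmain.trans ?_
  -- The initial outputs use up half of ε: λ₀ ≤ N² cancels the power of N, and 2 · 1/4 = 1/2 fixes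
  -- the constant `c₁`.
  have he1 : 2 * κ * N / D ≤ ε / 2 := by
    rw [hpow, hD] at hκε
    have h1 : lam₀ ≤ N ^ 2 := hNsq ▸ hlam₀n
    calc 2 * κ * N / D ≤ 2 * (1 / 4 * (ε * D * N ^ 2 / N ^ 3)) * N / D := by
          have : 1 / 4 * (ε * D * lam₀ / N ^ 3) ≤ 1 / 4 * (ε * D * N ^ 2 / N ^ 3) := by gcongr
          have := hκε.trans this
          gcongr
      _ = ε / 2 := by field_simp; norm_num
  have he2 : 100 * N ^ 6 / (M * lam₀ * κ * D ^ 3) * (2 / lam₀) * (8 * (N / D)) ≤ ε / 2 := by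
    -- This is the square root of the first width condition. The accumulated kernel error needs only
    -- N⁷ against λ₀², so one factor λ₀ is traded for N².
    have h1 : 10 ^ 4 * N ^ 9 ≤ M * lam₀ ^ 3 * ε * κ * D ^ 4 := by
      refine abs_le_of_sq_le_sq' ?_ (by positivity) |>.2
      rw [hMsq, hDsq, hNsq, ← mul_div_assoc, div_le_iff₀ (by positivity)] at hm1
      linarith
    have h2 : M * lam₀ ^ 3 * ε * κ * D ^ 4 ≤ M * lam₀ ^ 2 * ε * κ * D ^ 4 * N ^ 2 := by
      have h3 : lam₀ ≤ N ^ 2 := hNsq ▸ hlam₀n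
      have := mul_le_mul_of_nonneg_left h3 (by positivity : 0 ≤ M * lam₀ ^ 2 * ε * κ * D ^ 4)
      linarith
    have h3 : 10 ^ 4 * N ^ 7 ≤ M * lam₀ ^ 2 * ε * κ * D ^ 4 := by
      refine le_of_mul_le_mul_right ?_ (by positivity : 0 < N ^ 2)
      linarith
    have h4 : 100 * N ^ 6 / (M * lam₀ * κ * D ^ 3) * (2 / lam₀) * (8 * (N / D)) =
        1600 * N ^ 7 / (M * lam₀ ^ 2 * κ * D ^ 4) := by
      field_simp; ring
    rw [h4, div_le_div_iff₀ (by positivity) (by positivity)]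
    have : 0 < N ^ 7 := by positivity
    linarith
  linarith

end TwoLayer

/-! ### Choice of constants and conclusion -/

open TwoLayer in
theorem theorem1 :
    ∃ c₁ > (0 : ℝ), ∃ c₂ > (0 : ℝ), ∃ c₃ > (0 : ℝ),
      ∀ (n d m : ℕ)
        -- inputs, labels, and a realization of the random labels
        (x : Fin n → EuclideanSpace ℝ (Fin d)) (_ : ∀ i, ‖x i‖ = 1)
        (y : EuclideanSpace ℝ (Fin n)) (_ : ∀ i, |y i| ≤ 1)
        (y' : EuclideanSpace ℝ (Fin n)) (_ : ∀ i, y' i = 1 ∨ y' i = -1)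
        -- an eigen-decomposition of the Gram matrix, with smallest eigenvalue `lam₀`
        (lam : Fin n → ℝ) (v : OrthonormalBasis (Fin n) ℝ (EuclideanSpace ℝ (Fin n)))
        (_ : ∀ i, (TwoLayer.gramInf x).toEuclideanLin (v i) = lam i • v i)
        (lam₀ : ℝ) (_ : IsLeast (Set.range lam) lam₀) (_ : 0 < lam₀)
        -- accuracy, failure probability, initialization scale, width, learning rate
        (ε δ κ η : ℝ) (_ : 0 < δ) (_ : δ ≤ 1)
        (_ : 0 < ε)
        (_ : 0 < κ) (_ : κ ≤ 1) (_ : κ ≤ c₁ * (ε * √δ * lam₀ / (n : ℝ) ^ (3 / 2 : ℝ)))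
        (_ : c₂ * ((n : ℝ) ^ 9 / (lam₀ ^ 6 * ε ^ 2 * κ ^ 2 * δ ^ 4)) ≤ (m : ℝ))
        -- implied by the previous bound unless `ε > n ^ (3 / 2) / (lam₀ * √δ)`
        (_ : c₂ * ((n : ℝ) ^ 6 / (lam₀ ^ 4 * κ ^ 2 * δ ^ 3)) ≤ (m : ℝ))
        (_ : 0 < η) (_ : η ≤ c₃ * (lam₀ / (n : ℝ) ^ 2))
        -- numbers of steps on `y` and on `y'`
        (k k' : ℕ),
        ENNReal.ofReal (1 - δ) ≤ TwoLayer.initLaw m d κ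
          {ω | |‖TwoLayer.outputs x ω.2 (TwoLayer.weights η x y y' k ω.2 ω.1 (k + k')) - y'‖
            - √(∑ i, (inner ℝ (v i) y - inner ℝ (v i) y'
                - (1 - η * lam i) ^ k * inner ℝ (v i) y) ^ 2 * (1 - η * lam i) ^ (2 * k'))|
            ≤ ε} := by
  refine ⟨1 / 4, by norm_num, 10 ^ 8, by norm_num, 1, one_pos, ?_⟩
  intro n d m x hx y hy y' hy' lam v hv lam₀ hleast hlam₀ ε δ κ η hδ hδ1 hε hκ hκ1 hκε hm1 hm2
    hη hηle k k'
  have hn : 0 < n := by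
    obtain ⟨i, _⟩ := hleast.1
    exact i.pos
  have hn0 : (0 : ℝ) < n := Nat.cast_pos.2 hn
  have hm : 0 < m := by
    refine Nat.cast_pos.1 (lt_of_lt_of_le ?_ hm2)
    positivity
  have hm0 : (0 : ℝ) < m := Nat.cast_pos.2 hm
  have hbad := measure_not_typicalInit_le (R := 16 * n / (√m * √δ * lam₀)) hx hn hm hκ
    (by have := Real.sqrt_pos.2 hm0; have := Real.sqrt_pos.2 hδ; positivity) hδ
  rw [one_mul] at hηle
  have hprob : initLaw m d κ Set.univ = 1 := measure_univ
  -- Covering the whole space by the good event and the atypical initializations bounds the good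
  -- event from below without requiring it to be measurable.
  rw [ENNReal.ofReal_sub _ hδ.le, ENNReal.ofReal_one, tsub_le_iff_right, ← hprob]
  refine (measure_mono fun ω _ => ?_).trans ((measure_union_le _ _).trans
    (add_le_add le_rfl hbad))
  by_cases hω : TypicalInit x κ (16 * n / (√m * √δ * lam₀)) δ ω
  · exact Or.inl (abs_residual_sub_le_of_typicalInit hx hy hy' hv hleast hlam₀ hδ hδ1 hε hκ hκ1
      hκε hn hm hm1 hm2 hη hηle k k' hω)
  · exact Or.inr hω
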